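/- **Theorem.** A *two-outcome measurement* on $n$ qubits is a Hermitian $2^n\times 2^n$ matrix $E$ with all eigenvalues in $[0,1]$; applied to a mixed state $\rho$ it outputs $1$ with probability $\operatorname{Tr}(E\rho)$. For every $K>0$ there is a constant $c>0$, depending only on $K$, such that the following holds. Let $n\ge 1$ be an integer, let $\varepsilon,\delta\in(0,1/4)$, and let $$K\sqrt{n}\,2^{-n/70}\le\gamma<\tfrac12 .$$ Then there is a probability distribution $\mathcal D$ over two-outcome measurements on $n$ qubits such that: (i) If $m\ge 0$ is an integer with $$m\le c\cdot\frac1\varepsilon\left(\frac{n}{\gamma^2}+\log\frac1\delta\right),$$ then there is no (possibly randomized) learning algorithm that, for every $n$-qubit mixed state $\rho$, given measurements $\mathcal E=(E_1,\dots,E_m)$ drawn independently from $\mathcal D$ and any real numbers $p_1,\dots,p_m$ with $|p_i-\operatorname{Tr}(E_i\rho)|\le\gamma^2/n$ for all $i$, outputs a hypothesis state $\sigma$ (an $n$-qubit mixed state) such that $$\Pr_{E\sim\mathcal D}\bigl[\,|\operatorname{Tr}(E\sigma)-\operatorname{Tr}(E\rho)|>\gamma\,\bigr]\le\varepsilon$$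 with probability at least $1-\delta$ over $\mathcal E$ (and the internal randomness of the algorithm). (ii) If $m\ge 0$ is an integer with $$m\le c\cdot\frac1\varepsilon\left(\frac{n}{\gamma^4}+\log\frac1\delta\right),$$ then there is no (possibly randomized) learning algorithm that, for every $n$-qubit mixed state $\rho$, given measurements $\mathcal E=(E_1,\dots,E_m)$ drawn independently from $\mathcal D$ and bits $B=(b_1,\dots,b_m)$, where each $b_i$ is $1$ with independent probability $\operatorname{Tr}(E_i\rho)$, outputs a hypothesis state $\sigma$ such that $$\Pr_{E\sim\mathcal D}\bigl[\,|\operatorname{Tr}(E\sigma)-\operatorname{Tr}(E\rho)|>\gamma\,\bigr]\le\varepsilon$$ with probability at least $1-\delta$ over $\mathcal E$ and $B$ (and the internal randomness of the algorithm). -/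

import Mathlib

open MeasureTheory
open scoped ENNReal ComplexOrder

noncomputable section

namespace QuantumLearning

/-- Complex `2^n × 2^n` matrices, with rows and columns indexed by the computational basis
states of `n` qubits. -/
abbrev QMatrix (n : ℕ) : Type := Matrix (Fin n → Fin 2) (Fin n → Fin 2) ℂ

/-- `n`-qubit mixed states: positive semidefinite matrices of trace one. -/
def QState (n : ℕ) : Type := {ρ : QMatrix n // ρ.PosSemidef ∧ ρ.trace = 1}

/-- Two-outcome measurements on `n` qubits: Hermitian matrices `E` with all eigenvalues in
`[0, 1]`, that is, `0 ≤ E ≤ 1`. -/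
def Measurement (n : ℕ) : Type := {E : QMatrix n // E.PosSemidef ∧ (1 - E).PosSemidef}

instance (n : ℕ) : TopologicalSpace (QState n) := instTopologicalSpaceSubtype

instance (n : ℕ) : TopologicalSpace (Measurement n) := instTopologicalSpaceSubtype

instance (n : ℕ) : MeasurableSpace (QState n) := borel _

instance (n : ℕ) : BorelSpace (QState n) := ⟨rfl⟩

instance (n : ℕ) : MeasurableSpace (Measurement n) := borel _

instance (n : ℕ) : BorelSpace (Measurement n) := ⟨rfl⟩

/-- The acceptance probability `Tr (E ρ)`, which is a real number. -/
def acceptProb {n : ℕ} (E : Measurement n) (ρ : QState n) : ℝ := (E.1 * ρ.1).trace.re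

/-- The hypothesis states `σ` with `Pr_{E ∼ D} [|Tr (E σ) - Tr (E ρ)| > γ] ≤ ε`. -/
def goodHypotheses {n : ℕ} (D : Measure (Measurement n)) (ε γ : ℝ) (ρ : QState n) :
    Set (QState n) :=
  {σ | D {E | γ < |acceptProb E σ - acceptProb E ρ|} ≤ ENNReal.ofReal ε}

/-- A (possibly randomized) learning algorithm which receives `m` measurements together with one
datum in `β` for each of them, and outputs a hypothesis state. Its value is the law of the output;
a deterministic algorithm takes Dirac measures as values. -/
abbrev Learner (n m : ℕ) (β : Type) : Type :=
  (Fin m → Measurement n) → (Fin m → β) → ProbabilityMeasure (QState n)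

/-- The learner `A` works when it is given estimates with error at most `η`: whatever the unknown
state `ρ` is, and whatever valid estimates `p E i` of `Tr (E i ρ)` are handed to it on the sample
`E`, with probability at least `1 - δ` over `E ∼ D^m` (and the coins of `A`) it outputs a
hypothesis state that is good for `ρ`. -/
def LearnsFromEstimates {n m : ℕ} (D : Measure (Measurement n)) [IsProbabilityMeasure D]
    (ε δ γ η : ℝ) (A : Learner n m ℝ) : Prop :=
  ∀ (ρ : QState n) (p : (Fin m → Measurement n) → Fin m → ℝ), Measurable p →
    (∀ E i, |p E i - acceptProb (E i) ρ| ≤ η) →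
    ENNReal.ofReal (1 - δ) ≤
      ∫⁻ E, (A E (p E) : Measure (QState n)) (goodHypotheses D ε γ ρ)
        ∂(Measure.pi fun _ : Fin m => D)

/-- The probability of the outcomes `b` when each measurement `E i` is applied once, to its own
copy of `ρ`: the `b i` are independent, and `b i = true` has probability `Tr (E i ρ)`. -/
def outcomeProb {n m : ℕ} (E : Fin m → Measurement n) (ρ : QState n) (b : Fin m → Bool) : ℝ :=
  ∏ i, if b i then acceptProb (E i) ρ else 1 - acceptProb (E i) ρ

/-- The learner `A` works in the measure-once model: whatever the unknown state `ρ` is, with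
probability at least `1 - δ` over `E ∼ D^m` and the outcomes `b` (and the coins of `A`) it outputs
a hypothesis state that is good for `ρ`. -/
def LearnsFromOutcomes {n m : ℕ} (D : Measure (Measurement n)) [IsProbabilityMeasure D]
    (ε δ γ : ℝ) (A : Learner n m Bool) : Prop :=
  ∀ ρ : QState n,
    ENNReal.ofReal (1 - δ) ≤
      ∫⁻ E, ∑ b : Fin m → Bool, ENNReal.ofReal (outcomeProb E ρ b) *
        (A E b : Measure (QState n)) (goodHypotheses D ε γ ρ)
        ∂(Measure.pi fun _ : Fin m => D)

end QuantumLearning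

end

/-! The lower bound is already classical: all states and measurements used are diagonal. The aim is
to hide a string `b` of about `n / γ ^ 2` bits in a state `ρ b`, so that a measurement `E i` accepts
`ρ b` with probability `(1 ± β) / 2`, the sign being bit `i` of `b`, where `2 * γ < β` and `β` is of
order `γ` for fixed `K`.

Such a design (`exists_design`) splits the basis label into about `n / 2` free signs and a vector
`z` of `n / 2` bits. Coordinate `(u, v)` is the sign `u` times the character of `z` at `w v`, for a
Sidon family `w` of `M` vectors, `M` of order `γ ^ (-2)`. The Sidon property makes the first four
moments of signed character sums behave like those of independent signs, giving a Khinchine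
inequality. Choosing the free signs optimally turns it into a lower bound on the support function of
the points `F x`, and by Hahn–Banach every sign pattern scaled by `β` lies in their convex hull. The
condition on `γ` ensures that a Sidon family of the required size exists.

The law `D` gives the zero measurement with probability `1 - 7 / 2 * ε` and otherwise a uniform `E
i`. Since `γ < β / 2`, thresholding a good hypothesis at `1 / 2` recovers `b` outside a fraction `2
/ 7` of the coordinates. So a learner solves a recovery problem from sampled bits, exact in the
first model and seen through a channel of bias `β` in the second; this accounts for the extra factor
`1 / γ ^ 2`.

Recovery fails for two reasons. If the term in `n` dominates, too little information is available
per bit (`exists_recoveryProb_lt_of_chiSq`). If `log (1 / δ)` dominates, only the zero measurement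
is drawn with probability above `2 * δ` (`exists_recoveryProb_lt_of_unobserved`). -/

namespace QuantumLearning

/-! ### Sign characters on binary vectors and Sidon families -/

/-- The nontrivial sign character of `ZMod 2`. -/
def bitSign (x : ZMod 2) : ℝ := if x = 0 then 1 else -1

lemma bitSign_add (x y : ZMod 2) : bitSign (x + y) = bitSign x * bitSign y := by
  have h : ∀ z : ZMod 2, z = 0 ∨ z = 1 := by decide
  have h2 : (1 : ZMod 2) + 1 = 0 := by decide
  rcases h x with rfl | rfl <;> rcases h y with rfl | rfl <;> simp [bitSign, h2]

lemma abs_bitSign (x : ZMod 2) : |bitSign x| = 1 := by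
  unfold bitSign; split_ifs <;> simp

lemma sum_bitSign_mul (w : ZMod 2) : ∑ z : ZMod 2, bitSign (z * w) = if w = 0 then 2 else 0 := by
  have h : ∀ f : ZMod 2 → ℝ, ∑ z, f z = f 0 + f 1 := fun f => Fin.sum_univ_two f
  have hw : w = 0 ∨ w = 1 := by revert w; decide
  rw [h]
  rcases hw with rfl | rfl <;> norm_num [bitSign]

/-- The sign character `(-1)^⟨z, w⟩` on binary vectors. -/
def signChar {t : ℕ} (z w : Fin t → ZMod 2) : ℝ := ∏ i, bitSign (z i * w i)

lemma signChar_add {t : ℕ} (z w w' : Fin t → ZMod 2) :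
    signChar z (w + w') = signChar z w * signChar z w' := by
  simp [signChar, mul_add, bitSign_add, Finset.prod_mul_distrib]

lemma abs_signChar {t : ℕ} (z w : Fin t → ZMod 2) : |signChar z w| = 1 := by
  simp [signChar, Finset.abs_prod, abs_bitSign]

lemma sum_signChar {t : ℕ} (w : Fin t → ZMod 2) :
    ∑ z, signChar z w = if w = 0 then (2 : ℝ) ^ t else 0 := by
  unfold signChar
  rw [← Fintype.prod_sum (fun i (x : ZMod 2) => bitSign (x * w i))]
  simp only [sum_bitSign_mul]
  split_ifs with h
  · simp [h]
  · obtain ⟨i, hi⟩ := Function.ne_iff.mp h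
    exact Finset.prod_eq_zero (Finset.mem_univ i) (by simpa using hi)

/-- A family in a group of exponent two is Sidon if four of its members sum to zero only when they
pair up. -/
def IsSidon {V : Type*} [AddCommGroup V] {M : ℕ} (w : Fin M → V) : Prop :=
  ∀ a b c d, w a + w b + w c + w d = 0 → (a = b ∧ c = d) ∨ (a = c ∧ b = d) ∨ (a = d ∧ b = c)

/-- In exponent two, a triple sum with a repeated index collapses to a single member, so avoiding
triple sums also keeps `x` off the family itself. -/
lemma IsSidon.cons {V : Type*} [AddCommGroup V] (hV : ∀ v : V, v + v = 0) {M : ℕ} {w : Fin M → V}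
    (hw : IsSidon w) {x : V} (hx : ∀ a b c, w a + w b + w c ≠ x) :
    IsSidon (Fin.cons x w : Fin (M + 1) → V) := by
  have eq_of : ∀ u v : V, u + v = 0 → u = v := fun u v h => by
    rw [← add_left_inj v, h, hV]
  have hinj : ∀ a b, w a + w b = 0 → a = b := fun a b h => by
    have := hw a b a a (by rw [add_assoc, hV, add_zero, h])
    tauto
  have one : ∀ a b c, w a + w b + w c + x ≠ 0 := fun a b c h => hx a b c (eq_of _ _ h)
  have three : ∀ a, x + x + x + w a ≠ 0 := fun a h => by
    rw [hV, zero_add, add_comm] at h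
    exact hx a a a (by rw [hV, zero_add, eq_of _ _ h])
  intro a b c d
  refine Fin.cases ?_ (fun a => ?_) a <;> refine Fin.cases ?_ (fun b => ?_) b <;>
    refine Fin.cases ?_ (fun c => ?_) c <;> refine Fin.cases ?_ (fun d => ?_) d <;>
    simp only [Fin.cons_zero, Fin.cons_succ, Fin.succ_inj, true_and, and_true, Fin.succ_ne_zero,
      and_false, false_and, or_false, false_or, or_self, (Fin.succ_ne_zero _).symm] <;> intro h
  all_goals first
    | trivial
    | exact hw _ _ _ _ h
    | (apply hinj; rw [← h]; abel_nf; simp [two_zsmul, hV])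
    | (refine three a ?_; rw [← h]; abel1)
    | (refine three b ?_; rw [← h]; abel1)
    | (refine three c ?_; rw [← h]; abel1)
    | exact three d h
    | exact one a b c h
    | (refine one a b d ?_; rw [← h]; abel1)
    | (refine one a c d ?_; rw [← h]; abel1)
    | (refine one b c d ?_; rw [← h]; abel1)

/-- Greedy choice: `M` vectors have at most `M ^ 3` triple sums, so while `M ^ 3 < 2 ^ t` some
vector avoids them all. -/
lemma exists_isSidon (t : ℕ) : ∀ M : ℕ, M ^ 3 ≤ 2 ^ t →
    ∃ w : Fin M → (Fin t → ZMod 2), IsSidon w := by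
  intro M
  induction M with
  | zero => exact fun _ => ⟨Fin.elim0, fun a => a.elim0⟩
  | succ M ih =>
    intro h
    have h3 : M ^ 3 < 2 ^ t := lt_of_lt_of_le (Nat.pow_lt_pow_left M.lt_succ_self three_ne_zero) h
    obtain ⟨w, hw⟩ := ih h3.le
    let S : Finset (Fin t → ZMod 2) := Finset.univ.image
      fun p : Fin M × Fin M × Fin M => w p.1 + w p.2.1 + w p.2.2
    have hS : S.card < Fintype.card (Fin t → ZMod 2) := by
      refine lt_of_le_of_lt Finset.card_image_le ?_
      simp only [Finset.card_univ, Fintype.card_prod, Fintype.card_fin, Fintype.card_fun,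
        ZMod.card]
      calc M * (M * M) = M ^ 3 := by ring
        _ < _ := h3
    obtain ⟨x, hx⟩ : ∃ x, x ∉ S := by
      by_contra! hall
      exact hS.ne (by rw [Finset.eq_univ_of_forall hall, Finset.card_univ])
    refine ⟨Fin.cons x w, hw.cons (fun v => ?_) fun a b c hab => hx ?_⟩
    · ext i; exact CharTwo.add_self_eq_zero _
    · exact Finset.mem_image.mpr ⟨(a, b, c), Finset.mem_univ _, hab⟩

/-! ### Anticoncentration of signed sums from fourth moments -/

lemma sum_sum_signChar_sq {t M : ℕ} {w : Fin M → (Fin t → ZMod 2)} (hw : IsSidon w)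
    (y : Fin M → ℝ) :
    ∑ z, (∑ v, y v * signChar z (w v)) ^ 2 = 2 ^ t * ∑ v, y v ^ 2 := by
  have hV : ∀ v : Fin t → ZMod 2, v + v = 0 := fun v => by
    ext i; exact CharTwo.add_self_eq_zero _
  have hinj : ∀ a b, w a + w b = 0 ↔ a = b := fun a b => by
    refine ⟨fun h => ?_, fun h => by rw [h, hV]⟩
    have := hw a b a a (by rw [add_assoc, hV, add_zero, h])
    tauto
  calc _ = ∑ z, ∑ a, ∑ b, y a * y b * signChar z (w a + w b) := by
        refine Finset.sum_congr rfl fun z _ => ?_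
        rw [sq, Finset.sum_mul_sum]
        refine Finset.sum_congr rfl fun a _ => Finset.sum_congr rfl fun b _ => ?_
        rw [signChar_add]; ring
    _ = ∑ a, ∑ b, y a * y b * ∑ z, signChar z (w a + w b) := by
        rw [Finset.sum_comm]
        refine Finset.sum_congr rfl fun a _ => ?_
        rw [Finset.sum_comm]
        simp only [Finset.mul_sum]
    _ = _ := by
        simp only [sum_signChar, hinj, mul_ite, mul_zero, Finset.sum_ite_eq, Finset.mem_univ,
          if_true, Finset.mul_sum]
        exact Finset.sum_congr rfl fun a _ => by ring

/-- Summing over `z` kills every quadruple whose vectors do not add to zero. The Sidon property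
leaves the three pairings; the bound is not an equality because `a = b = c = d` is counted in each
of them. -/
lemma sum_sum_signChar_pow_four_le {t M : ℕ} {w : Fin M → (Fin t → ZMod 2)} (hw : IsSidon w)
    (y : Fin M → ℝ) :
    ∑ z, (∑ v, y v * signChar z (w v)) ^ 4 ≤ 2 ^ t * (3 * (∑ v, y v ^ 2) ^ 2) := by
  calc _ = ∑ z, ∑ a, ∑ b, ∑ c, ∑ d,
          y a * y b * y c * y d * signChar z (w a + w b + w c + w d) := by
        refine Finset.sum_congr rfl fun z _ => ?_
        simp only [signChar_add]
        rw [show ∀ r : ℝ, r ^ 4 = r * (r * (r * r)) from fun r => by ring, Finset.sum_mul]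
        refine Finset.sum_congr rfl fun a _ => ?_
        rw [Finset.sum_mul, Finset.mul_sum]
        refine Finset.sum_congr rfl fun b _ => ?_
        rw [Finset.sum_mul, Finset.mul_sum, Finset.mul_sum]
        refine Finset.sum_congr rfl fun c _ => ?_
        rw [Finset.mul_sum, Finset.mul_sum, Finset.mul_sum]
        refine Finset.sum_congr rfl fun d _ => ?_
        ring
    _ = ∑ a, ∑ b, ∑ c, ∑ d,
          y a * y b * y c * y d * ∑ z, signChar z (w a + w b + w c + w d) := by
        rw [Finset.sum_comm]
        refine Finset.sum_congr rfl fun a _ => ?_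
        rw [Finset.sum_comm]
        refine Finset.sum_congr rfl fun b _ => ?_
        rw [Finset.sum_comm]
        refine Finset.sum_congr rfl fun c _ => ?_
        rw [Finset.sum_comm]
        simp only [Finset.mul_sum]
    _ ≤ ∑ a, ∑ b, ∑ c, ∑ d, 2 ^ t *
          ((if a = b then if c = d then y a ^ 2 * y c ^ 2 else 0 else 0)
          + (if a = c then if b = d then y a ^ 2 * y b ^ 2 else 0 else 0)
          + (if b = c then if a = d then y a ^ 2 * y b ^ 2 else 0 else 0)) := by
        refine Finset.sum_le_sum fun a _ => Finset.sum_le_sum fun b _ =>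
          Finset.sum_le_sum fun c _ => Finset.sum_le_sum fun d _ => ?_
        have hnn : ∀ (P Q : Prop) [Decidable P] [Decidable Q] (r r' : ℝ),
            0 ≤ if P then if Q then r ^ 2 * r' ^ 2 else 0 else 0 := fun P Q _ _ r r' => by
          split_ifs <;> positivity
        rw [sum_signChar]
        by_cases h : w a + w b + w c + w d = 0
        · rw [if_pos h, mul_comm]
          refine mul_le_mul_of_nonneg_left ?_ (by positivity)
          have h1 := hnn (a = b) (c = d) (y a) (y c)
          have h2 := hnn (a = c) (b = d) (y a) (y b)
          have h3 := hnn (b = c) (a = d) (y a) (y b)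
          rcases hw a b c d h with ⟨rfl, rfl⟩ | ⟨rfl, rfl⟩ | ⟨rfl, rfl⟩
          · simp only [if_true] at h1 ⊢; nlinarith
          · simp only [if_true] at h2 ⊢; nlinarith
          · simp only [if_true] at h3 ⊢; nlinarith
        · rw [if_neg h, mul_zero]
          exact mul_nonneg (by positivity) (add_nonneg (add_nonneg (hnn ..) (hnn ..)) (hnn ..))
    _ = _ := by
        simp only [← Finset.mul_sum, Finset.sum_add_distrib]
        congr 1
        have e : (∑ v, y v ^ 2) ^ 2 = ∑ a, ∑ b, y a ^ 2 * y b ^ 2 := by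
          rw [sq, Finset.sum_mul_sum]
        have e1 : ∑ a, ∑ b, ∑ c, ∑ d, (if a = b then if c = d then y a ^ 2 * y c ^ 2 else 0 else 0)
            = (∑ v, y v ^ 2) ^ 2 := by
          rw [e]
          refine Finset.sum_congr rfl fun a _ => ?_
          rw [Finset.sum_comm]
          refine Finset.sum_congr rfl fun c _ => ?_
          rw [Finset.sum_comm]
          simp [Finset.sum_ite_eq]
        have e2 : ∑ a, ∑ b, ∑ c, ∑ d, (if a = c then if b = d then y a ^ 2 * y b ^ 2 else 0 else 0)
            = (∑ v, y v ^ 2) ^ 2 := by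
          rw [e]
          refine Finset.sum_congr rfl fun a _ => Finset.sum_congr rfl fun b _ => ?_
          rw [Finset.sum_comm]
          simp
        have e3 : ∑ a, ∑ b, ∑ c, ∑ d, (if b = c then if a = d then y a ^ 2 * y b ^ 2 else 0 else 0)
            = (∑ v, y v ^ 2) ^ 2 := by
          rw [e]
          refine Finset.sum_congr rfl fun a _ => Finset.sum_congr rfl fun b _ => ?_
          rw [Finset.sum_comm]
          simp
        rw [e1, e2, e3]; ring

/-- The two sides touch at `|r| = 3 / 2 * σ`. With second moment `σ ^ 2` and fourth moment at most
`3 * σ ^ 4`, averaging gives the constant `1 - 4 / 9 = 5 / 9`. -/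
lemma le_abs_of_fourth_moment {σ : ℝ} (hσ : 0 < σ) (r : ℝ) :
    r ^ 2 / σ - 4 / 27 * (r ^ 4 / σ ^ 3) ≤ |r| := by
  have h : r ^ 2 / σ - 4 / 27 * (r ^ 4 / σ ^ 3) =
      |r| - 4 / 27 * |r| * ((|r| / σ - 3 / 2) ^ 2 * (|r| / σ + 3)) := by
    rw [← sq_abs, show r ^ 4 = |r| ^ 4 by rw [show (4 : ℕ) = 2 * 2 by rfl, pow_mul, pow_mul, sq_abs]]
    field_simp
    ring
  rw [h]
  have : 0 ≤ 4 / 27 * |r| * ((|r| / σ - 3 / 2) ^ 2 * (|r| / σ + 3)) := by positivity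
  linarith

lemma sum_abs_signChar_ge_l2 {t M : ℕ} {w : Fin M → (Fin t → ZMod 2)} (hw : IsSidon w)
    (y : Fin M → ℝ) :
    2 ^ t * (5 / 9 * √(∑ v, y v ^ 2)) ≤ ∑ z, |∑ v, y v * signChar z (w v)| := by
  set σ := √(∑ v, y v ^ 2) with hσ_def
  have hσ2 : σ ^ 2 = ∑ v, y v ^ 2 := Real.sq_sqrt (Finset.sum_nonneg fun _ _ => sq_nonneg _)
  rcases (Real.sqrt_nonneg _ : 0 ≤ σ).eq_or_lt with h0 | hσ
  · rw [hσ_def, ← h0]; simp only [mul_zero]; exact Finset.sum_nonneg fun _ _ => abs_nonneg _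
  have h4 := sum_sum_signChar_pow_four_le hw y
  have h2 := sum_sum_signChar_sq hw y
  rw [← hσ2] at h4 h2
  calc (2 : ℝ) ^ t * (5 / 9 * σ)
      = 2 ^ t * σ ^ 2 / σ - 4 / 27 * (2 ^ t * (3 * (σ ^ 2) ^ 2) / σ ^ 3) := by
        field_simp; ring
    _ ≤ (∑ z, (∑ v, y v * signChar z (w v)) ^ 2) / σ
        - 4 / 27 * ((∑ z, (∑ v, y v * signChar z (w v)) ^ 4) / σ ^ 3) := by
        rw [h2]; gcongr
    _ = ∑ z, ((∑ v, y v * signChar z (w v)) ^ 2 / σ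
        - 4 / 27 * ((∑ v, y v * signChar z (w v)) ^ 4 / σ ^ 3)) := by
        rw [Finset.sum_sub_distrib, Finset.sum_div, Finset.sum_div, Finset.mul_sum]
    _ ≤ _ := Finset.sum_le_sum fun z _ => le_abs_of_fourth_moment hσ _

lemma sum_abs_signChar_ge {t M : ℕ} {w : Fin M → (Fin t → ZMod 2)} (hw : IsSidon w)
    (y : Fin M → ℝ) :
    2 ^ t * (5 / (9 * √M) * ∑ v, |y v|) ≤ ∑ z, |∑ v, y v * signChar z (w v)| := by
  refine le_trans ?_ (sum_abs_signChar_ge_l2 hw y)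
  have h : ∑ v, |y v| ≤ √M * √(∑ v, y v ^ 2) := by
    rw [← Real.sqrt_mul (Nat.cast_nonneg _)]
    refine Real.le_sqrt_of_sq_le ?_
    have := Finset.sum_mul_sq_le_sq_mul_sq Finset.univ (fun _ : Fin M => (1 : ℝ)) (fun v => |y v|)
    simpa using this
  refine mul_le_mul_of_nonneg_left ?_ (by positivity)
  rcases (Nat.cast_nonneg M : (0 : ℝ) ≤ M).eq_or_lt with h0 | hM
  · rw [← h0]; simp
  · have : 0 < √(M : ℝ) := Real.sqrt_pos.mpr hM
    calc 5 / (9 * √M) * ∑ v, |y v| ≤ 5 / (9 * √M) * (√M * √(∑ v, y v ^ 2)) := by gcongr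
      _ = _ := by field_simp

/-! ### Sign cubes inside convex hulls -/

/-- If `β • e` were outside the convex hull of the points `F x`, a separating functional `y` would
satisfy `∑ i, y i * F x i < β * ∑ i, |y i|` for all `x`, against `hF`. -/
lemma exists_stdSimplex_of_support {X ι : Type*} [Fintype X] [Fintype ι] (F : X → ι → ℝ) {β : ℝ}
    (hF : ∀ y : ι → ℝ, ∃ x, β * ∑ i, |y i| ≤ ∑ i, y i * F x i) (e : ι → ℝ) (he : ∀ i, |e i| ≤ 1)
    (hβ : 0 ≤ β) : ∃ p ∈ stdSimplex ℝ X, ∀ i, ∑ x, p x * F x i = β * e i := by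
  classical
  let Φ : (X → ℝ) →ₗ[ℝ] (ι → ℝ) :=
    { toFun := fun p i => ∑ x, p x * F x i
      map_add' := fun p q => by ext i; simp [add_mul, Finset.sum_add_distrib]
      map_smul' := fun r p => by ext i; simp [Finset.mul_sum, mul_assoc] }
  by_contra hne
  have hmem : (fun i => β * e i) ∉ Φ '' stdSimplex ℝ X := by
    rintro ⟨p, hp, h⟩
    exact hne ⟨p, hp, fun i => congrFun h i⟩
  obtain ⟨f, u, hu, hfu⟩ := geometric_hahn_banach_closed_point
    ((convex_stdSimplex ℝ X).linear_image Φ)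
    ((isCompact_stdSimplex ℝ X).image Φ.continuous_of_finiteDimensional).isClosed hmem
  have hf : ∀ v : ι → ℝ, f v = ∑ i, f (Pi.single i 1) * v i := fun v => by
    conv_lhs => rw [pi_eq_sum_univ' v]
    simp [mul_comm]
  obtain ⟨x, hx⟩ := hF fun i => f (Pi.single i 1)
  have h1 := hu (Φ (Pi.single x 1)) ⟨_, single_mem_stdSimplex ℝ x, rfl⟩
  have h2 : Φ (Pi.single x 1) = F x := by
    ext i; simp [Φ, Pi.single_apply]
  rw [h2, hf] at h1
  rw [hf] at hfu
  have h3 : ∑ i, f (Pi.single i 1) * (β * e i) ≤ β * ∑ i, |f (Pi.single i 1)| := by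
    rw [Finset.mul_sum]
    refine Finset.sum_le_sum fun i _ => ?_
    calc f (Pi.single i 1) * (β * e i) = β * (f (Pi.single i 1) * e i) := by ring
      _ ≤ β * (|f (Pi.single i 1)| * 1) := by
        refine mul_le_mul_of_nonneg_left ((le_abs_self _).trans ?_) hβ
        rw [abs_mul]
        exact mul_le_mul_of_nonneg_left (he i) (abs_nonneg _)
      _ = _ := by ring
  linarith

/-- For a functional `y`, some `z` does at least as well as the average in `hβ` summed over the `s`
blocks; the free sign of each block is then chosen to turn its inner sum into an absolute value. -/
lemma exists_signed_design {t M : ℕ} (s : ℕ) (h : (Fin t → ZMod 2) → Fin M → ℝ)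
    (hh : ∀ z v, |h z v| ≤ 1) {β : ℝ}
    (hβ : ∀ y : Fin M → ℝ, 2 ^ t * (β * ∑ v, |y v|) ≤ ∑ z, |∑ v, y v * h z v|) (hβ0 : 0 ≤ β) :
    ∃ F : (Fin (s + t) → Fin 2) → Fin s × Fin M → ℝ, (∀ x i, |F x i| ≤ 1) ∧
      ∀ e : Fin s × Fin M → ℝ, (∀ i, |e i| ≤ 1) →
        ∃ p ∈ stdSimplex ℝ (Fin (s + t) → Fin 2), ∀ i, ∑ x, p x * F x i = β * e i := by
  have hcard : Fintype.card (Fin (s + t) → Fin 2)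
      = Fintype.card ((Fin s → ZMod 2) × (Fin t → ZMod 2)) := by
    simp [pow_add, ZMod.card]
  let φ := Fintype.equivOfCardEq hcard
  refine ⟨fun x i => bitSign ((φ x).1 i.1) * h (φ x).2 i.2, fun x i => ?_, fun e he =>
    exists_stdSimplex_of_support _ (fun y => ?_) e he hβ0⟩
  · rw [abs_mul, abs_bitSign, one_mul]; exact hh _ _
  · obtain ⟨z, hz⟩ : ∃ z, β * ∑ i, |y i| ≤ ∑ u, |∑ v, y (u, v) * h z v| := by
      by_contra! hlt
      have h1 : ∑ z, ∑ u, |∑ v, y (u, v) * h z v| < ∑ _z : Fin t → ZMod 2, β * ∑ i, |y i| :=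
        Finset.sum_lt_sum_of_nonempty Finset.univ_nonempty fun z _ => hlt z
      have h2 : ∑ u, 2 ^ t * (β * ∑ v, |y (u, v)|) ≤ ∑ u, ∑ z, |∑ v, y (u, v) * h z v| :=
        Finset.sum_le_sum fun u _ => hβ fun v => y (u, v)
      rw [Finset.sum_comm, ← Finset.mul_sum, ← Finset.mul_sum, ← Fintype.sum_prod_type'
        (f := fun u v => |y (u, v)|)] at h2
      simp only [Finset.sum_const, Finset.card_univ, Fintype.card_fun, ZMod.card, Fintype.card_fin,
        nsmul_eq_mul, Nat.cast_pow, Nat.cast_ofNat] at h1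
      exact absurd (h2.trans_lt h1) (lt_irrefl _)
    refine ⟨φ.symm (fun u => if 0 ≤ ∑ v, y (u, v) * h z v then 0 else 1, z), hz.trans_eq ?_⟩
    rw [Fintype.sum_prod_type]
    refine Finset.sum_congr rfl fun u _ => ?_
    simp only [Equiv.apply_symm_apply]
    rw [show ∀ r : ℝ, ∑ v, y (u, v) * (r * h z v) = r * ∑ v, y (u, v) * h z v from fun r => by
      rw [Finset.mul_sum]; exact Finset.sum_congr rfl fun v _ => by ring]
    split_ifs with h0
    · rw [abs_of_nonneg h0]; simp [bitSign]
    · rw [abs_of_neg (not_le.mp h0)]; simp [bitSign]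

lemma natPow_three_le_of_le_rpow {n M : ℕ} (h : 16 * (M : ℝ) ≤ 2 ^ ((n : ℝ) / 35)) (hM : 1 ≤ M) :
    M ^ 3 ≤ 2 ^ (n / 2) := by
  have hM' : (1 : ℝ) ≤ M := by exact_mod_cast hM
  -- For smaller `n` the right side of `h` is at most `2`, while the left is at least `16`. The
  -- bound on `n` absorbs the rounding in `n / 2`.
  have hn : 35 ≤ n := by
    by_contra! hlt
    have h1 : (2 : ℝ) ^ ((n : ℝ) / 35) ≤ 2 ^ (1 : ℝ) :=
      Real.rpow_le_rpow_of_exponent_le one_le_two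
        (by rw [div_le_one (by norm_num)]; exact_mod_cast hlt.le)
    rw [Real.rpow_one] at h1
    linarith
  have h2 : (M : ℝ) ^ 3 ≤ 2 ^ (n / 2) := by
    calc (M : ℝ) ^ 3 ≤ ((2 : ℝ) ^ ((n : ℝ) / 35)) ^ 3 := by gcongr; linarith
      _ = 2 ^ ((n : ℝ) / 35 * (3 : ℕ)) := by rw [Real.rpow_mul_natCast (by norm_num)]
      _ ≤ 2 ^ ((n / 2 : ℕ) : ℝ) := by
        refine Real.rpow_le_rpow_of_exponent_le one_le_two ?_
        have h3 : (n : ℝ) ≤ 2 * (n / 2 : ℕ) + 1 := by exact_mod_cast (by omega : n ≤ 2 * (n / 2) + 1)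
        have h4 : (35 : ℝ) ≤ n := by exact_mod_cast hn
        push_cast at *
        linarith
      _ = _ := Real.rpow_natCast _ _
  exact_mod_cast h2

/-- For every sign pattern on the `s * M` test functions `F`, some distribution on basis states
realizes exactly that pattern with common bias `β`, where `β` is comparable to `γ` and `s * M` is
comparable to `n / γ ^ 2`. -/
theorem exists_design {K γ : ℝ} {n : ℕ} (hK : 0 < K) (hK1 : K ≤ 1) (hn : 0 < n)
    (hγ : K * √(n : ℝ) * (2 : ℝ) ^ (-(n : ℝ) / 70) ≤ γ) (hγ2 : γ < 1 / 2) :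
    ∃ (s M : ℕ) (β : ℝ) (F : (Fin n → Fin 2) → Fin s × Fin M → ℝ), 0 < s ∧ 0 < M ∧
      2 * γ < β ∧ β ≤ 1 ∧ β ^ 2 ≤ 32 * γ ^ 2 / K ^ 2 ∧ n * K ^ 2 / (64 * γ ^ 2) ≤ s * M ∧
      (∀ x i, |F x i| ≤ 1) ∧ ∀ e : Fin s × Fin M → ℝ, (∀ i, |e i| ≤ 1) →
        ∃ p ∈ stdSimplex ℝ (Fin n → Fin 2), ∀ i, ∑ x, p x * F x i = β * e i := by
  have hn1 : (1 : ℝ) ≤ n := by exact_mod_cast hn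
  have hγ0 : 0 < γ := lt_of_lt_of_le (by positivity) hγ
  have hsplit : n - n / 2 + n / 2 = n := by omega
  have hs : 0 < n - n / 2 := by omega
  have hs2 : (n : ℝ) ≤ 2 * (n - n / 2 : ℕ) := by exact_mod_cast (by omega : n ≤ 2 * (n - n / 2))
  set q := K ^ 2 / (16 * γ ^ 2) with hq
  have hq0 : 0 < q := by positivity
  have hKγ : K ^ 2 = 16 * γ ^ 2 * q := by rw [hq]; field_simp
  have key : ∀ (M : ℕ) (β : ℝ), 0 < M → q ≤ 2 * M → 2 * γ < β → β ≤ 1 →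
      β ^ 2 ≤ 32 * γ ^ 2 / K ^ 2 → ∀ h : (Fin (n / 2) → ZMod 2) → Fin M → ℝ,
      (∀ z v, |h z v| ≤ 1) →
      (∀ y : Fin M → ℝ, 2 ^ (n / 2) * (β * ∑ v, |y v|) ≤ ∑ z, |∑ v, y v * h z v|) →
      ∃ (s M : ℕ) (β : ℝ) (F : (Fin n → Fin 2) → Fin s × Fin M → ℝ), 0 < s ∧ 0 < M ∧
      2 * γ < β ∧ β ≤ 1 ∧ β ^ 2 ≤ 32 * γ ^ 2 / K ^ 2 ∧ n * K ^ 2 / (64 * γ ^ 2) ≤ s * M ∧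
      (∀ x i, |F x i| ≤ 1) ∧ ∀ e : Fin s × Fin M → ℝ, (∀ i, |e i| ≤ 1) →
        ∃ p ∈ stdSimplex ℝ (Fin n → Fin 2), ∀ i, ∑ x, p x * F x i = β * e i := by
    intro M β hM hqM h1 h2 h3 h hh hβ
    have hd := exists_signed_design (n - n / 2) h hh hβ (by linarith)
    rw [hsplit] at hd
    obtain ⟨F, hF1, hF2⟩ := hd
    refine ⟨n - n / 2, M, β, F, hs, hM, h1, h2, h3, ?_, hF1, hF2⟩
    calc n * K ^ 2 / (64 * γ ^ 2) = n / 2 * (q / 2) := by rw [hKγ]; field_simp; norm_num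
      _ ≤ (n - n / 2 : ℕ) * M := by gcongr <;> linarith
  -- When `q < 2`, `γ` is bounded below in terms of `K`, and the trivial block `M = 1`, `β = 1`
  -- suffices. Otherwise `M = ⌊q⌋₊`.
  by_cases hq2 : q < 2
  · refine key 1 1 one_pos (by simpa using hq2.le) (by linarith) le_rfl ?_ (fun _ _ => 1)
      (by simp) (fun y => ?_)
    · rw [le_div_iff₀ (by positivity), hKγ]; nlinarith [sq_nonneg γ]
    · simp
  · push Not at hq2
    have hM2 : 2 ≤ ⌊q⌋₊ := Nat.le_floor (by exact_mod_cast hq2)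
    have hM2' : (2 : ℝ) ≤ ⌊q⌋₊ := by exact_mod_cast hM2
    have hMq : (⌊q⌋₊ : ℝ) ≤ q := Nat.floor_le hq0.le
    have hqM : q ≤ 2 * (⌊q⌋₊ : ℝ) := by linarith [Nat.lt_floor_add_one q]
    generalize ⌊q⌋₊ = M at hM2 hM2' hMq hqM
    have hM0 : (0 : ℝ) < √M := Real.sqrt_pos.mpr (by linarith)
    have hβ2 : (5 / (9 * √(M : ℝ))) ^ 2 = 25 / (81 * M) := by
      rw [div_pow, mul_pow, Real.sq_sqrt (by linarith)]; norm_num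
    have hγn : K ^ 2 * (2 : ℝ) ^ (-(n : ℝ) / 35) ≤ γ ^ 2 := by
      have h1 : K * (2 : ℝ) ^ (-(n : ℝ) / 70) ≤ γ := by
        refine le_trans ?_ hγ
        have : 1 ≤ √(n : ℝ) := Real.one_le_sqrt.mpr hn1
        gcongr
        nlinarith
      calc K ^ 2 * (2 : ℝ) ^ (-(n : ℝ) / 35) = (K * (2 : ℝ) ^ (-(n : ℝ) / 70)) ^ 2 := by
            rw [mul_pow, ← Real.rpow_mul_natCast (by norm_num)]; congr 2; push_cast; ring
        _ ≤ γ ^ 2 := by gcongr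
    obtain ⟨w, hw⟩ := exists_isSidon (n / 2) M (natPow_three_le_of_le_rpow (by
      have h1 : q * 16 ≤ 2 ^ ((n : ℝ) / 35) := by
        rw [neg_div, Real.rpow_neg (by norm_num)] at hγn
        rw [hq, div_mul_eq_mul_div, div_le_iff₀ (by positivity)]
        have h2 : (0 : ℝ) < 2 ^ ((n : ℝ) / 35) := by positivity
        rw [← div_eq_mul_inv, div_le_iff₀ h2] at hγn
        linarith
      linarith) (by omega))
    refine key M (5 / (9 * √M)) (by omega) hqM ?_ ?_ ?_ (fun z v => signChar z (w v))
      (fun z v => (abs_signChar _ _).le) (sum_abs_signChar_ge hw)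
    -- Since `γ ^ 2 * M ≤ K ^ 2 / 16 ≤ 1 / 16`, the claim reduces to `324 / 16 < 25`.
    · refine lt_of_pow_lt_pow_left₀ 2 (by positivity) ?_
      rw [hβ2, lt_div_iff₀ (by positivity)]
      have : γ ^ 2 * M ≤ γ ^ 2 * q := by gcongr
      nlinarith
    · refine le_of_sq_le_sq ?_ one_pos.le
      rw [hβ2, div_le_iff₀ (by positivity)]; linarith
    · rw [hβ2, div_le_div_iff₀ (by positivity) (by positivity), hKγ]
      have : γ ^ 2 * q ≤ γ ^ 2 * (2 * M) := by gcongr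
      nlinarith [sq_nonneg γ]

/-! ### A coordinatewise two-point lower bound -/

/-- Changing measure costs at most the mean of `|R - 1|`, with `R` the product likelihood ratio.
This is bounded by `θ / 2 + (R - 1) ^ 2 / (2 * θ)`, and the second moment of `R` tensorizes to `(1 +
κ) ^ m`. -/
lemma sum_prod_mul_ge_of_chiSq {α : Type*} [Fintype α] {m : ℕ} {u r : α → ℝ} {κ θ : ℝ}
    (hu : ∀ a, 0 ≤ u a) (hu1 : ∑ a, u a = 1) (hr1 : ∑ a, u a * r a = 1)
    (hr2 : ∑ a, u a * r a ^ 2 = 1 + κ) (hθ : 0 < θ) (f : (Fin m → α) → ℝ)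
    (hf0 : ∀ d, 0 ≤ f d) (hf1 : ∀ d, f d ≤ 1) :
    ∑ d, (∏ l, u (d l)) * f d - (θ / 2 + ((1 + κ) ^ m - 1) / (2 * θ)) ≤
      ∑ d, (∏ l, u (d l) * r (d l)) * f d := by
  have hU1 : ∑ d : Fin m → α, ∏ l, u (d l) = 1 := by rw [← Fintype.sum_pow, hu1, one_pow]
  have hR1 : ∑ d : Fin m → α, (∏ l, u (d l)) * ∏ l, r (d l) = 1 := by
    simp only [← Finset.prod_mul_distrib]
    rw [← Fintype.sum_pow (fun a => u a * r a), hr1, one_pow]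
  have hR2 : ∑ d : Fin m → α, (∏ l, u (d l)) * (∏ l, r (d l)) ^ 2 = (1 + κ) ^ m := by
    simp only [← Finset.prod_mul_distrib, ← Finset.prod_pow]
    rw [← Fintype.sum_pow (fun a => u a * r a ^ 2), hr2]
  have hpt : ∀ d : Fin m → α, (∏ l, u (d l)) * f d - (∏ l, u (d l)) *
      (θ / 2 + ((∏ l, r (d l)) ^ 2 - 2 * ∏ l, r (d l) + 1) / (2 * θ)) ≤
      (∏ l, u (d l) * r (d l)) * f d := fun d => by
    rw [Finset.prod_mul_distrib, ← mul_sub, mul_assoc]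
    refine mul_le_mul_of_nonneg_left ?_ (Finset.prod_nonneg fun _ _ => hu _)
    generalize ∏ l, r (d l) = R
    have h1 : |R - 1| ≤ θ / 2 + (R ^ 2 - 2 * R + 1) / (2 * θ) := by
      have : θ / 2 + (R ^ 2 - 2 * R + 1) / (2 * θ) - |R - 1| = (θ - |R - 1|) ^ 2 / (2 * θ) := by
        rw [show R ^ 2 - 2 * R + 1 = |R - 1| ^ 2 by rw [sq_abs]; ring]
        field_simp; ring
      have h2 : 0 ≤ (θ - |R - 1|) ^ 2 / (2 * θ) := by positivity
      linarith
    have h3 := neg_abs_le (R - 1)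
    have h4 : -|R - 1| ≤ (R - 1) * f d := by
      nlinarith [hf0 d, hf1 d, abs_nonneg (R - 1)]
    linarith
  refine le_trans (le_of_eq ?_) (Finset.sum_le_sum fun d _ => hpt d)
  rw [Finset.sum_sub_distrib]
  congr 1
  calc θ / 2 + ((1 + κ) ^ m - 1) / (2 * θ)
      = (∑ d : Fin m → α, ∏ l, u (d l)) * (θ / 2)
        + ((∑ d : Fin m → α, (∏ l, u (d l)) * (∏ l, r (d l)) ^ 2)
          - 2 * (∑ d : Fin m → α, (∏ l, u (d l)) * ∏ l, r (d l))
          + ∑ d : Fin m → α, ∏ l, u (d l)) / (2 * θ) := by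
        rw [hU1, hR1, hR2]; ring
    _ = _ := by
        rw [Finset.mul_sum, ← Finset.sum_sub_distrib, ← Finset.sum_add_distrib, Finset.sum_div,
          Finset.sum_mul, ← Finset.sum_add_distrib]
        exact Finset.sum_congr rfl fun d _ => by ring

/-! ### Recovering a hidden bit string from noisy samples of its coordinates. -/

section Recovery

variable {ι : Type*} [Fintype ι]

/-- The law of one observation: with probability `1 - τ` nothing is observed, and otherwise a
uniformly random coordinate of `b` is shown through a binary symmetric channel of bias `β`. -/
noncomputable def obsProb (τ β : ℝ) (b : ι → Bool) : Option ι × Bool → ℝ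
  | (none, x) => if x then 0 else 1 - τ
  | (some i, x) => τ / Fintype.card ι * ((1 + β * (if x = b i then 1 else -1)) / 2)

lemma sum_option_bool (f : Option ι × Bool → ℝ) :
    ∑ a, f a = (f (none, true) + f (none, false)) + ∑ i, (f (some i, true) + f (some i, false)) := by
  rw [Fintype.sum_prod_type, Fintype.sum_option]
  simp

lemma obsProb_nonneg {τ β : ℝ} (hτ : 0 ≤ τ) (hτ1 : τ ≤ 1) (hβ : 0 ≤ β) (hβ1 : β ≤ 1)
    (b : ι → Bool) (a) : 0 ≤ obsProb τ β b a := by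
  rcases a with ⟨_ | i, x⟩
  · change (0 : ℝ) ≤ if x = true then 0 else 1 - τ
    split_ifs <;> linarith
  · unfold obsProb
    refine mul_nonneg (by positivity) ?_
    split_ifs <;> linarith

lemma sum_obsProb [Nonempty ι] (τ β : ℝ) (b : ι → Bool) : ∑ a, obsProb τ β b a = 1 := by
  have hk : (Fintype.card ι : ℝ) ≠ 0 := by exact_mod_cast Fintype.card_ne_zero
  have h : ∀ i, obsProb τ β b (some i, true) + obsProb τ β b (some i, false)
      = τ / Fintype.card ι := fun i => by
    cases hb : b i <;> simp [obsProb, hb] <;> ring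
  rw [sum_option_bool]
  simp only [h]
  simp [obsProb]
  field_simp
  ring

variable [DecidableEq ι]

/-- The law of one observation when coordinate `i` is shown through a useless channel. -/
noncomputable def maskedProb (τ β : ℝ) (b : ι → Bool) (i : ι) : Option ι × Bool → ℝ
  | (none, x) => if x then 0 else 1 - τ
  | (some j, x) => τ / Fintype.card ι *
      (if j = i then 1 / 2 else (1 + β * (if x = b j then 1 else -1)) / 2)

/-- The likelihood ratio of `obsProb` with respect to `maskedProb`. -/
noncomputable def maskedRatio (β : ℝ) (b : ι → Bool) (i : ι) : Option ι × Bool → ℝ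
  | (none, _) => 1
  | (some j, x) => if j = i then 1 + β * (if x = b j then 1 else -1) else 1

lemma maskedProb_mul_maskedRatio (τ β : ℝ) (b : ι → Bool) (i : ι) (a) :
    maskedProb τ β b i a * maskedRatio β b i a = obsProb τ β b a := by
  rcases a with ⟨_ | j, x⟩
  · simp [maskedProb, maskedRatio, obsProb]
  · by_cases h : j = i <;> simp [maskedProb, maskedRatio, obsProb, h]
    ring

lemma maskedProb_update (τ β : ℝ) (b : ι → Bool) (i : ι) (c : Bool) :
    maskedProb τ β (Function.update b i c) i = maskedProb τ β b i := by
  funext ⟨o, x⟩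
  cases o with
  | none => rfl
  | some j => by_cases h : j = i <;> simp [maskedProb, h]

lemma maskedProb_nonneg {τ β : ℝ} (hτ : 0 ≤ τ) (hτ1 : τ ≤ 1) (hβ : 0 ≤ β) (hβ1 : β ≤ 1)
    (b : ι → Bool) (i : ι) (a) : 0 ≤ maskedProb τ β b i a := by
  rcases a with ⟨_ | j, x⟩
  · change (0 : ℝ) ≤ if x = true then 0 else 1 - τ
    split_ifs <;> linarith
  · unfold maskedProb
    refine mul_nonneg (by positivity) ?_
    split_ifs <;> linarith

lemma sum_maskedProb [Nonempty ι] (τ β : ℝ) (b : ι → Bool) (i : ι) :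
    ∑ a, maskedProb τ β b i a = 1 := by
  have hk : (Fintype.card ι : ℝ) ≠ 0 := by exact_mod_cast Fintype.card_ne_zero
  have h : ∀ j, maskedProb τ β b i (some j, true) + maskedProb τ β b i (some j, false)
      = τ / Fintype.card ι := fun j => by
    by_cases hj : j = i <;> cases hb : b j <;> simp [maskedProb, hb, hj] <;> ring
  rw [sum_option_bool]
  simp only [h]
  simp [maskedProb]
  field_simp
  ring

lemma sum_maskedProb_mul_sq [Nonempty ι] (τ β : ℝ) (b : ι → Bool) (i : ι) :
    ∑ a, maskedProb τ β b i a * maskedRatio β b i a ^ 2 = 1 + β ^ 2 * τ / Fintype.card ι := by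
  have h : ∀ j, maskedProb τ β b i (some j, true) * maskedRatio β b i (some j, true) ^ 2
      + maskedProb τ β b i (some j, false) * maskedRatio β b i (some j, false) ^ 2
      = (maskedProb τ β b i (some j, true) + maskedProb τ β b i (some j, false))
        + if j = i then β ^ 2 * τ / Fintype.card ι else 0 := fun j => by
    by_cases hj : j = i
    · subst hj
      cases hb : b j <;> simp [maskedProb, maskedRatio, hb] <;> ring
    · simp [maskedRatio, hj]
  have h1 := sum_maskedProb τ β b i
  rw [sum_option_bool] at h1 ⊢
  simp only [h, Finset.sum_add_distrib, Finset.sum_ite_eq', Finset.mem_univ, if_true]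
  rw [← Finset.sum_add_distrib]
  rw [← h1]
  simp only [maskedRatio]
  ring

/-- The success probability of the randomized rule `ν`, when `b` has to be recovered up to a
`2 / 7` fraction of its coordinates. -/
noncomputable def recoveryProb {m : ℕ} (τ β : ℝ) (ν : (Fin m → Option ι × Bool) → (ι → Bool) → ℝ)
    (b : ι → Bool) : ℝ :=
  ∑ d : Fin m → Option ι × Bool, (∏ l, obsProb τ β b (d l)) *
    ∑ g, if (hammingDist g b : ℝ) ≤ 2 / 7 * Fintype.card ι then ν d g else 0

/-- Pair `b` with its flip at `i`. Masking coordinate `i` makes the two data laws equal, so the two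
error probabilities add up to `1`; unmasking costs at most `3 / 100` each. The bound `9 / 10000` in
`hm` is the square of the choice `θ = 3 / 100`. -/
lemma sum_wrong_ge [Nonempty ι] {m : ℕ} {τ β : ℝ} (hτ : 0 ≤ τ) (hτ1 : τ ≤ 1) (hβ : 0 ≤ β)
    (hβ1 : β ≤ 1) (hm : (1 + β ^ 2 * τ / Fintype.card ι) ^ m ≤ 1 + 9 / 10000)
    {ν : (Fin m → Option ι × Bool) → (ι → Bool) → ℝ} (hν0 : ∀ d g, 0 ≤ ν d g)
    (hν1 : ∀ d, ∑ g, ν d g = 1) (i : ι) :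
    (1 / 2 - 3 / 100) * 2 ^ Fintype.card ι ≤ ∑ b, ∑ d : Fin m → Option ι × Bool,
      (∏ l, obsProb τ β b (d l)) * ∑ g, if g i ≠ b i then ν d g else 0 := by
  set W : (ι → Bool) → ℝ := fun b => ∑ d : Fin m → Option ι × Bool,
      (∏ l, obsProb τ β b (d l)) * ∑ g, if g i ≠ b i then ν d g else 0 with hW
  let flip : (ι → Bool) → (ι → Bool) := fun b => Function.update b i (!b i)
  have hflip : Function.Involutive flip := fun b => by simp [flip]
  have h1 : ∀ b, ∑ d : Fin m → Option ι × Bool, (∏ l, maskedProb τ β b i (d l)) *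
      (∑ g, if g i ≠ b i then ν d g else 0) - 3 / 100 ≤ W b := fun b => by
    have := sum_prod_mul_ge_of_chiSq (m := m) (κ := β ^ 2 * τ / Fintype.card ι) (θ := 3 / 100)
      (maskedProb_nonneg hτ hτ1 hβ hβ1 b i) (sum_maskedProb τ β b i)
      (by simp only [maskedProb_mul_maskedRatio, sum_obsProb]) (sum_maskedProb_mul_sq τ β b i)
      (by norm_num) (fun d => ∑ g, if g i ≠ b i then ν d g else 0)
      (fun d => Finset.sum_nonneg fun g _ => by split_ifs <;> simp [hν0])
      (fun d => (Finset.sum_le_sum fun g _ => by split_ifs <;> simp [hν0]).trans (hν1 d).le)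
    simp only [maskedProb_mul_maskedRatio] at this
    refine le_trans ?_ this
    have h : ((1 + β ^ 2 * τ / Fintype.card ι) ^ m - 1) / (2 * (3 / 100)) ≤ 3 / 200 := by
      rw [div_le_iff₀ (by norm_num)]; linarith
    linarith
  have h2 : ∀ b, 1 - 6 / 100 ≤ W b + W (flip b) := fun b => by
    have h3 := h1 b
    have h4 := h1 (flip b)
    simp only [flip, maskedProb_update, Function.update_self] at h4
    have h5 : ∑ d : Fin m → Option ι × Bool, (∏ l, maskedProb τ β b i (d l)) *
        (∑ g, if g i ≠ b i then ν d g else 0)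
        + ∑ d : Fin m → Option ι × Bool, (∏ l, maskedProb τ β b i (d l)) *
        (∑ g, if g i ≠ !b i then ν d g else 0) = 1 := by
      rw [← Finset.sum_add_distrib]
      calc _ = ∑ d : Fin m → Option ι × Bool, ∏ l, maskedProb τ β b i (d l) := by
            refine Finset.sum_congr rfl fun d _ => ?_
            rw [← mul_add, ← Finset.sum_add_distrib]
            conv_rhs => rw [← mul_one (∏ l, _), ← hν1 d]
            congr 1
            refine Finset.sum_congr rfl fun g _ => ?_
            cases g i <;> cases b i <;> simp
        _ = 1 := by rw [← Fintype.sum_pow, sum_maskedProb, one_pow]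
    linarith
  have h6 : ∑ b, W (flip b) = ∑ b, W b := Equiv.sum_comp hflip.toPerm W
  have h7 : ∑ _b : ι → Bool, ((1 : ℝ) - 6 / 100) ≤ ∑ b, (W b + W (flip b)) :=
    Finset.sum_le_sum fun b _ => h2 b
  rw [Finset.sum_add_distrib, h6] at h7
  simp only [Finset.sum_const, Finset.card_univ, Fintype.card_fun, Fintype.card_bool, nsmul_eq_mul,
    Nat.cast_pow, Nat.cast_ofNat] at h7
  linarith

theorem exists_recoveryProb_lt_of_chiSq [Nonempty ι] {m : ℕ} {τ β : ℝ} (hτ : 0 ≤ τ) (hτ1 : τ ≤ 1)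
    (hβ : 0 ≤ β) (hβ1 : β ≤ 1) (hm : (1 + β ^ 2 * τ / Fintype.card ι) ^ m ≤ 1 + 9 / 10000)
    {ν : (Fin m → Option ι × Bool) → (ι → Bool) → ℝ} (hν0 : ∀ d g, 0 ≤ ν d g)
    (hν1 : ∀ d, ∑ g, ν d g = 1) : ∃ b, recoveryProb τ β ν b < 3 / 4 := by
  by_contra! hall
  have hk : (0 : ℝ) < Fintype.card ι := by exact_mod_cast Fintype.card_pos
  have h1 : ∑ _i : ι, (1 / 2 - 3 / 100) * (2 : ℝ) ^ Fintype.card ι ≤ _ :=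
    Finset.sum_le_sum fun i _ => sum_wrong_ge hτ hτ1 hβ hβ1 hm hν0 hν1 i
  rw [Finset.sum_comm] at h1
  have h2 : ∀ b : ι → Bool, ∑ i, ∑ d : Fin m → Option ι × Bool, (∏ l, obsProb τ β b (d l)) *
      (∑ g, if g i ≠ b i then ν d g else 0) ≤
      Fintype.card ι * (1 - 5 / 7 * recoveryProb τ β ν b) := fun b => by
    have hP : ∑ d : Fin m → Option ι × Bool, ∏ l, obsProb τ β b (d l) = 1 := by
      rw [← Fintype.sum_pow, sum_obsProb, one_pow]
    rw [Finset.sum_comm]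
    calc _ = ∑ d : Fin m → Option ι × Bool, (∏ l, obsProb τ β b (d l)) *
          ∑ g, ν d g * hammingDist g b := by
          refine Finset.sum_congr rfl fun d _ => ?_
          rw [← Finset.mul_sum, Finset.sum_comm]
          congr 1
          refine Finset.sum_congr rfl fun g _ => ?_
          rw [← Finset.sum_filter, Finset.sum_const, nsmul_eq_mul, mul_comm]
          rfl
      _ ≤ ∑ d : Fin m → Option ι × Bool, (∏ l, obsProb τ β b (d l)) * (Fintype.card ι *
          (1 - 5 / 7 * ∑ g, if (hammingDist g b : ℝ) ≤ 2 / 7 * Fintype.card ι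
            then ν d g else 0)) := by
          refine Finset.sum_le_sum fun d _ => mul_le_mul_of_nonneg_left ?_
            (Finset.prod_nonneg fun _ _ => obsProb_nonneg hτ hτ1 hβ hβ1 _ _)
          rw [← hν1 d, Finset.mul_sum, ← Finset.sum_sub_distrib, Finset.mul_sum]
          refine Finset.sum_le_sum fun g _ => ?_
          have h3 : (hammingDist g b : ℝ) ≤ Fintype.card ι := by
            exact_mod_cast hammingDist_le_card_fintype
          have h4 := hν0 d g
          split_ifs with h
          · nlinarith
          · nlinarith
      _ = Fintype.card ι * (1 - 5 / 7 * recoveryProb τ β ν b) := by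
          conv_rhs => rw [← hP, recoveryProb, Finset.mul_sum, ← Finset.sum_sub_distrib,
            Finset.mul_sum]
          exact Finset.sum_congr rfl fun d _ => by ring
  have h3 := h1.trans (Finset.sum_le_sum fun b _ => (h2 b).trans
    (mul_le_mul_of_nonneg_left (sub_le_sub_left (mul_le_mul_of_nonneg_left (hall b)
      (by norm_num)) 1) hk.le))
  simp only [Finset.sum_const, Finset.card_univ, Fintype.card_fun, Fintype.card_bool, nsmul_eq_mul,
    Nat.cast_pow, Nat.cast_ofNat] at h3
  have h4 : (0 : ℝ) < Fintype.card ι * 2 ^ Fintype.card ι := by positivity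
  nlinarith

/-- On data showing no coordinate the guess does not depend on `b`. Its distances to `b` and to the
complement of `b` add up to the length, so it fails for at least one of them: averaged over `b`,
failure has probability at least `(1 - τ) ^ m / 2 > δ`. -/
theorem exists_recoveryProb_lt_of_unobserved [Nonempty ι] {m : ℕ} {τ β δ : ℝ} (hτ : 0 ≤ τ)
    (hτ1 : τ ≤ 1) (hβ : 0 ≤ β) (hβ1 : β ≤ 1) (hm : 2 * δ < (1 - τ) ^ m)
    {ν : (Fin m → Option ι × Bool) → (ι → Bool) → ℝ} (hν0 : ∀ d g, 0 ≤ ν d g)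
    (hν1 : ∀ d, ∑ g, ν d g = 1) : ∃ b, recoveryProb τ β ν b < 1 - δ := by
  by_contra! hall
  let d₀ : Fin m → Option ι × Bool := fun _ => (none, false)
  let c : (ι → Bool) → (ι → Bool) → ℝ := fun g b =>
    if (hammingDist g b : ℝ) ≤ 2 / 7 * Fintype.card ι then 0 else 1
  have hk : (0 : ℝ) < Fintype.card ι := by exact_mod_cast Fintype.card_pos
  let compl : (ι → Bool) → (ι → Bool) := fun b i => !b i
  have hcompl : Function.Involutive compl := fun b => by funext i; simp [compl]
  have hc : ∀ g, (2 : ℝ) ^ Fintype.card ι ≤ 2 * ∑ b, c g b := fun g => by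
    have h1 : ∑ b, c g (compl b) = ∑ b, c g b := Equiv.sum_comp hcompl.toPerm (c g)
    have h2 : ∑ _b : ι → Bool, (1 : ℝ) ≤ ∑ b, (c g b + c g (compl b)) := by
      refine Finset.sum_le_sum fun b _ => ?_
      have h3 : hammingDist g b + hammingDist g (compl b) = Fintype.card ι := by
        simp only [hammingDist, compl]
        rw [← Finset.card_univ, ← Finset.card_filter_add_card_filter_not (s := Finset.univ)
          (fun i => g i ≠ b i)]
        congr 2
        ext i
        cases g i <;> cases b i <;> simp
      have h4 : (hammingDist g b : ℝ) + hammingDist g (compl b) = Fintype.card ι := by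
        exact_mod_cast h3
      simp only [c]
      split_ifs <;> linarith
    rw [Finset.sum_add_distrib, h1] at h2
    simp only [Finset.sum_const, Finset.card_univ, Fintype.card_fun, Fintype.card_bool,
      nsmul_eq_mul, Nat.cast_pow, Nat.cast_ofNat] at h2
    linarith
  have hb : ∀ b, recoveryProb τ β ν b ≤ 1 - (1 - τ) ^ m * ∑ g, ν d₀ g * c g b := fun b => by
    have hP : ∑ d : Fin m → Option ι × Bool, ∏ l, obsProb τ β b (d l) = 1 := by
      rw [← Fintype.sum_pow, sum_obsProb, one_pow]
    have hnn : ∀ d : Fin m → Option ι × Bool, 0 ≤ ∏ l, obsProb τ β b (d l) := fun d =>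
      Finset.prod_nonneg fun _ _ => obsProb_nonneg hτ hτ1 hβ hβ1 _ _
    have hcnn : ∀ g, 0 ≤ c g b := fun g => by simp only [c]; split_ifs <;> norm_num
    have h1 : recoveryProb τ β ν b =
        1 - ∑ d : Fin m → Option ι × Bool, (∏ l, obsProb τ β b (d l)) * ∑ g, ν d g * c g b := by
      rw [← hP, recoveryProb, ← Finset.sum_sub_distrib]
      refine Finset.sum_congr rfl fun d _ => ?_
      conv_rhs => rw [← mul_one (∏ l, obsProb τ β b (d l)), mul_assoc, ← mul_sub, one_mul, ← hν1 d,
        ← Finset.sum_sub_distrib]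
      congr 1
      refine Finset.sum_congr rfl fun g _ => ?_
      simp only [c]
      split_ifs <;> simp
    rw [h1]
    have h2 := Finset.single_le_sum (f := fun d : Fin m → Option ι × Bool =>
      (∏ l, obsProb τ β b (d l)) * ∑ g, ν d g * c g b)
      (fun d _ => mul_nonneg (hnn d) (Finset.sum_nonneg fun g _ => mul_nonneg (hν0 d g) (hcnn g)))
      (Finset.mem_univ d₀)
    have h3 : ∏ l, obsProb τ β b (d₀ l) = (1 - τ) ^ m := by simp [d₀, obsProb]
    simp only [h3] at h2
    linarith
  have h1 : ∑ _b : ι → Bool, (1 - δ) ≤ _ := Finset.sum_le_sum fun b _ => (hall b).trans (hb b)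
  rw [Finset.sum_sub_distrib, Finset.sum_sub_distrib, ← Finset.mul_sum, Finset.sum_comm] at h1
  simp only [← Finset.mul_sum] at h1
  have h2 : (2 : ℝ) ^ Fintype.card ι ≤ 2 * ∑ g, ν d₀ g * ∑ b, c g b := by
    calc (2 : ℝ) ^ Fintype.card ι = ∑ g, ν d₀ g * 2 ^ Fintype.card ι := by
          rw [← Finset.sum_mul, hν1, one_mul]
      _ ≤ ∑ g, ν d₀ g * (2 * ∑ b, c g b) :=
          Finset.sum_le_sum fun g _ => mul_le_mul_of_nonneg_left (hc g) (hν0 _ _)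
      _ = _ := by rw [Finset.mul_sum]; exact Finset.sum_congr rfl fun g _ => by ring
  have h3 : 0 ≤ (1 - τ) ^ m := pow_nonneg (by linarith) m
  simp only [Finset.sum_const, Finset.card_univ, Fintype.card_fun, Fintype.card_bool, nsmul_eq_mul,
    Nat.cast_pow, Nat.cast_ofNat] at h1
  have h4 := mul_le_mul_of_nonneg_left h2 h3
  have h5 : (0 : ℝ) < 2 ^ Fintype.card ι := by positivity
  have h6 := mul_lt_mul_of_pos_right hm h5
  linarith

end Recovery

/-! ### Diagonal states and measurements -/

lemma continuous_acceptProb_left {n : ℕ} (ρ : QState n) :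
    Continuous fun E : Measurement n => acceptProb E ρ := by
  have h : Continuous fun E : Measurement n => E.1 := continuous_subtype_val
  exact Complex.continuous_re.comp (h.matrix_mul continuous_const).matrix_trace

lemma continuous_acceptProb_right {n : ℕ} (E : Measurement n) :
    Continuous fun ρ : QState n => acceptProb E ρ := by
  have h : Continuous fun ρ : QState n => ρ.1 := continuous_subtype_val
  exact Complex.continuous_re.comp (continuous_const.matrix_mul h).matrix_trace

lemma exists_measurement_state {n : ℕ} : ∃ (toE : {f : (Fin n → Fin 2) → ℝ // ∀ x, 0 ≤ f x ∧ f x ≤ 1} →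
    Measurement n) (toS : stdSimplex ℝ (Fin n → Fin 2) → QState n),
    ∀ f p, acceptProb (toE f) (toS p) = ∑ x, f.1 x * p.1 x := by
  refine ⟨fun f => ⟨Matrix.diagonal fun x => (f.1 x : ℂ), ?_, ?_⟩,
    fun p => ⟨Matrix.diagonal fun x => (p.1 x : ℂ), ?_, ?_⟩, fun f p => ?_⟩
  · exact Matrix.PosSemidef.diagonal fun x => by simpa using (f.2 x).1
  · rw [← Matrix.diagonal_one, Matrix.diagonal_sub]
    refine Matrix.PosSemidef.diagonal fun x => ?_
    have h : (0 : ℂ) ≤ ((1 - f.1 x : ℝ) : ℂ) := Complex.zero_le_real.mpr (by linarith [(f.2 x).2])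
    simpa using h
  · exact Matrix.PosSemidef.diagonal fun x => by simpa using p.2.1 x
  · rw [Matrix.trace_diagonal, ← Complex.ofReal_sum, p.2.2, Complex.ofReal_one]
  · simp [acceptProb, Matrix.diagonal_mul_diagonal, Matrix.trace_diagonal]

/-! ### Finitely supported sampling -/

/-- Only an inequality is claimed because `f` need not be measurable: a `Learner` is an arbitrary
function of its data. -/
lemma lintegral_pi_map_le {J Y : Type*} [Fintype J] [MeasurableSpace J] [DiscreteMeasurableSpace J]
    [MeasurableSpace Y] (μ : Measure J) [IsProbabilityMeasure μ] (e : J → Y) {m : ℕ}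
    (f : (Fin m → Y) → ℝ≥0∞) :
    ∫⁻ E, f E ∂(Measure.pi fun _ : Fin m => μ.map e) ≤
      ∑ j : Fin m → J, (∏ l, μ {j l}) * f fun l => e (j l) := by
  have he : Measurable e := Measurable.of_discrete
  have : IsProbabilityMeasure (μ.map e) := Measure.isProbabilityMeasure_map he.aemeasurable
  rw [← Measure.pi_map_pi (μ := fun _ : Fin m => μ) (f := fun _ => e) fun _ => he.aemeasurable]
  refine (lintegral_map_le _ _).trans (le_of_eq ?_)
  rw [lintegral_fintype]
  exact Finset.sum_congr rfl fun j _ => by rw [Measure.pi_singleton, mul_comm]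

/-- The weight `1 - τ` on the trivial index, and a total weight `τ` spread evenly over `ι`. -/
noncomputable def sampleWeight {ι : Type*} [Fintype ι] (τ : ℝ) : Option ι → ℝ
  | none => 1 - τ
  | some _ => τ / Fintype.card ι

/-- The sampling law with weights `sampleWeight`. -/
noncomputable def sampleLaw {ι : Type*} [Fintype ι] [MeasurableSpace (Option ι)] (τ : ℝ) :
    Measure (Option ι) :=
  ∑ o, ENNReal.ofReal (sampleWeight τ o) • Measure.dirac o

section Sampling

variable {ι : Type*} [Fintype ι]

lemma sampleWeight_nonneg {τ : ℝ} (hτ : 0 ≤ τ) (hτ1 : τ ≤ 1) (o : Option ι) :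
    0 ≤ sampleWeight τ o := by
  cases o with
  | none => exact sub_nonneg.mpr hτ1
  | some i => exact div_nonneg hτ (Nat.cast_nonneg _)

lemma sum_sampleWeight [Nonempty ι] (τ : ℝ) : ∑ o : Option ι, sampleWeight τ o = 1 := by
  have hk : (Fintype.card ι : ℝ) ≠ 0 := by exact_mod_cast Fintype.card_ne_zero
  rw [Fintype.sum_option]
  simp [sampleWeight]
  field_simp
  ring

variable [MeasurableSpace (Option ι)] [DiscreteMeasurableSpace (Option ι)]

omit [DiscreteMeasurableSpace (Option ι)] in
lemma isProbabilityMeasure_sampleLaw [Nonempty ι] {τ : ℝ} (hτ : 0 ≤ τ) (hτ1 : τ ≤ 1) :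
    IsProbabilityMeasure (sampleLaw τ : Measure (Option ι)) := by
  refine ⟨?_⟩
  simp only [sampleLaw, Measure.finsetSum_apply, Measure.smul_apply, measure_univ, smul_eq_mul,
    mul_one]
  rw [← ENNReal.ofReal_sum_of_nonneg fun o _ => sampleWeight_nonneg hτ hτ1 o, sum_sampleWeight,
    ENNReal.ofReal_one]

lemma sampleLaw_apply (τ : ℝ) (s : Set (Option ι)) [DecidablePred (· ∈ s)] :
    sampleLaw τ s = ∑ o, if o ∈ s then ENNReal.ofReal (sampleWeight τ o) else 0 := by
  simp only [sampleLaw, Measure.finsetSum_apply, Measure.smul_apply, smul_eq_mul]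
  refine Finset.sum_congr rfl fun o _ => ?_
  rw [Measure.dirac_apply' _ (MeasurableSet.of_discrete)]
  by_cases h : o ∈ s <;> simp [h]

lemma sampleLaw_singleton (τ : ℝ) (o : Option ι) :
    sampleLaw τ {o} = ENNReal.ofReal (sampleWeight τ o) := by
  classical
  rw [sampleLaw_apply]
  simp

end Sampling

/-! ### Learners as recovery rules -/

section Learning

variable {n : ℕ} {ι : Type} [Fintype ι] [DecidableEq ι]

/-- The measurement attached to an index, the index `none` standing for the given measurement
`E₀`. -/
def extendMeasurement (E₀ : Measurement n) (E : ι → Measurement n) : Option ι → Measurement n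
  | none => E₀
  | some i => E i

/-- The sign pattern suggested by a hypothesis state. -/
noncomputable def guess (E : ι → Measurement n) (σ : QState n) : ι → Bool :=
  fun i => decide (1 / 2 < acceptProb (E i) σ)

omit [Fintype ι] [DecidableEq ι] in
lemma measurable_guess (E : ι → Measurement n) : Measurable (guess E) := by
  refine measurable_pi_lambda _ fun i => ?_
  refine measurable_to_bool ?_
  have h : (fun σ => guess E σ i) ⁻¹' {true} = {σ | 1 / 2 < acceptProb (E i) σ} := by
    ext σ; simp [guess]
  rw [h]
  exact (isOpen_lt continuous_const (continuous_acceptProb_right (E i))).measurableSet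

/-- The recovery rule defined by a randomized choice of hypothesis states. -/
noncomputable def guessLaw {m : ℕ} (E : ι → Measurement n)
    (A : (Fin m → Option ι) → (Fin m → Bool) → ProbabilityMeasure (QState n))
    (d : Fin m → Option ι × Bool) (g : ι → Bool) : ℝ :=
  (A (fun l => (d l).1) fun l => (d l).2 : Measure (QState n)).real (guess E ⁻¹' {g})

lemma sum_guessLaw {m : ℕ} (E : ι → Measurement n)
    (A : (Fin m → Option ι) → (Fin m → Bool) → ProbabilityMeasure (QState n))
    (d : Fin m → Option ι × Bool) : ∑ g, guessLaw E A d g = 1 := by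
  unfold guessLaw
  rw [sum_measureReal_preimage_singleton _ fun g _ => measurable_guess E (measurableSet_singleton g)]
  simp

lemma ofReal_le_map_sampleLaw [MeasurableSpace (Option ι)] [DiscreteMeasurableSpace (Option ι)]
    (τ : ℝ) (E₀ : Measurement n) (E : ι → Measurement n) (S : Set (Measurement n))
    (T : Finset ι) (hT : ∀ i ∈ T, E i ∈ S) :
    ENNReal.ofReal (T.card * (τ / Fintype.card ι)) ≤
      (sampleLaw τ).map (extendMeasurement E₀ E) S := by
  classical
  refine le_trans ?_ (Measure.le_map_apply Measurable.of_discrete.aemeasurable S)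
  rw [sampleLaw_apply, Fintype.sum_option]
  refine le_trans ?_ le_add_self
  calc ENNReal.ofReal (T.card * (τ / Fintype.card ι))
      = ∑ i ∈ T, ENNReal.ofReal (τ / Fintype.card ι) := by
        rw [Finset.sum_const, nsmul_eq_mul, ENNReal.ofReal_mul (Nat.cast_nonneg _),
          ENNReal.ofReal_natCast]
    _ = ∑ i, if i ∈ T then ENNReal.ofReal (τ / Fintype.card ι) else 0 := by
        rw [Finset.sum_ite_mem, Finset.univ_inter]
    _ ≤ _ := by
        refine Finset.sum_le_sum fun i _ => ?_
        by_cases hi : i ∈ T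
        · have : some i ∈ extendMeasurement E₀ E ⁻¹' S := hT i hi
          simp [hi, this, sampleWeight]
        · simp [hi]

/-- Each wrong bit puts `acceptProb (E i) σ` on the wrong side of `1 / 2`, hence at distance at
least `β / 2 > γ` from the truth, and has mass `7 / 2 * ε` over the number of coordinates. Total
mass at most `ε` leaves a fraction at most `2 / 7`. -/
lemma hammingDist_guess_le [Nonempty ι] [MeasurableSpace (Option ι)]
    [DiscreteMeasurableSpace (Option ι)] {ε γ β : ℝ} (hε : 0 < ε) (hβ : 2 * γ < β)
    (E₀ : Measurement n) (E : ι → Measurement n) {ρ : QState n} {b : ι → Bool}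
    (hρ : ∀ i, acceptProb (E i) ρ = (1 + β * (if b i then 1 else -1)) / 2) {σ : QState n}
    (hσ : σ ∈ goodHypotheses ((sampleLaw (7 / 2 * ε)).map (extendMeasurement E₀ E)) ε γ ρ) :
    (hammingDist (guess E σ) b : ℝ) ≤ 2 / 7 * Fintype.card ι := by
  have hk : (0 : ℝ) < Fintype.card ι := by exact_mod_cast Fintype.card_pos
  have h1 := (ofReal_le_map_sampleLaw (7 / 2 * ε) E₀ E
    {F | γ < |acceptProb F σ - acceptProb F ρ|} (Finset.univ.filter fun i => guess E σ i ≠ b i)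
    (fun i hi => by
      have hi' : guess E σ i ≠ b i := (Finset.mem_filter.mp hi).2
      change γ < |acceptProb (E i) σ - acceptProb (E i) ρ|
      rw [hρ i]
      cases hb : b i
      · have : 1 / 2 < acceptProb (E i) σ := by simpa [guess, hb] using hi'
        refine lt_of_lt_of_le ?_ (le_abs_self _)
        simp
        linarith
      · have : acceptProb (E i) σ ≤ 1 / 2 := by simpa [guess, hb] using hi'
        refine lt_of_lt_of_le ?_ (neg_le_abs _)
        simp
        linarith)).trans hσ
  rw [ENNReal.ofReal_le_ofReal_iff hε.le] at h1
  change (hammingDist (guess E σ) b : ℝ) * _ ≤ ε at h1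
  rw [← mul_div_assoc, div_le_iff₀ hk] at h1
  have h2 : ε * (hammingDist (guess E σ) b * (7 / 2)) ≤ ε * Fintype.card ι := by linarith
  have h3 := le_of_mul_le_mul_left h2 hε
  linarith

lemma sum_le_ofReal_recoveryProb {m : ℕ} {τ β : ℝ} (hτ : 0 ≤ τ) (hτ1 : τ ≤ 1) (hβ : 0 ≤ β)
    (hβ1 : β ≤ 1) (E : ι → Measurement n) {b : ι → Bool} {G : Set (QState n)}
    (hG : ∀ σ ∈ G, (hammingDist (guess E σ) b : ℝ) ≤ 2 / 7 * Fintype.card ι)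
    (A : (Fin m → Option ι) → (Fin m → Bool) → ProbabilityMeasure (QState n)) :
    ∑ j, ∑ x, ENNReal.ofReal (∏ l, obsProb τ β b (j l, x l)) * (A j x : Measure (QState n)) G ≤
      ENNReal.ofReal (recoveryProb τ β (guessLaw E A) b) := by
  have hnn : ∀ d : Fin m → Option ι × Bool, 0 ≤ ∏ l, obsProb τ β b (d l) := fun d =>
    Finset.prod_nonneg fun _ _ => obsProb_nonneg hτ hτ1 hβ hβ1 _ _
  have hs : ∀ d : Fin m → Option ι × Bool, 0 ≤ ∑ g,
      if (hammingDist g b : ℝ) ≤ 2 / 7 * Fintype.card ι then guessLaw E A d g else 0 := fun d =>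
    Finset.sum_nonneg fun g _ => by split_ifs <;> simp [guessLaw]
  rw [recoveryProb, ENNReal.ofReal_sum_of_nonneg fun d _ => mul_nonneg (hnn d) (hs d),
    ← (Equiv.arrowProdEquivProdArrow (Fin m) (fun _ => Option ι) fun _ => Bool).symm.sum_comp,
    Fintype.sum_prod_type]
  refine Finset.sum_le_sum fun j _ => Finset.sum_le_sum fun x _ => ?_
  rw [ENNReal.ofReal_mul (hnn _)]
  refine mul_le_mul_right ?_ _
  have hsub : G ⊆ guess E ⁻¹' (Finset.univ.filter fun g : ι → Bool =>
      (hammingDist g b : ℝ) ≤ 2 / 7 * Fintype.card ι) := fun σ hσ => by simpa using hG σ hσ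
  refine (measure_mono hsub).trans ?_
  rw [← Finset.sum_filter]
  unfold guessLaw
  rw [sum_measureReal_preimage_singleton _ fun g _ => measurable_guess E (measurableSet_singleton g),
    ofReal_measureReal]
  exact le_rfl

omit [DecidableEq ι] in
lemma obsProb_eq_mul (τ β : ℝ) (b : ι → Bool) (o : Option ι) (x : Bool) :
    obsProb τ β b (o, x) = sampleWeight τ o * (match o with
      | none => if x then 0 else 1
      | some i => (1 + β * (if x = b i then 1 else -1)) / 2) := by
  cases o with
  | none => cases x <;> simp [obsProb, sampleWeight]
  | some i => rfl

theorem not_learnsFromOutcomes [Nonempty ι] [MeasurableSpace (Option ι)]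
    [DiscreteMeasurableSpace (Option ι)] {m : ℕ} {ε δ γ β : ℝ} (hε : 0 < ε) (hε1 : ε < 1 / 4)
    (hβ0 : 0 ≤ β) (hβ1 : β ≤ 1) (hγβ : 2 * γ < β) {E₀ : Measurement n} {E : ι → Measurement n}
    {ρ : (ι → Bool) → QState n} (hρ₀ : ∀ b, acceptProb E₀ (ρ b) = 0)
    (hρ : ∀ b i, acceptProb (E i) (ρ b) = (1 + β * (if b i then 1 else -1)) / 2)
    (hrec : ∀ ν : (Fin m → Option ι × Bool) → (ι → Bool) → ℝ, (∀ d g, 0 ≤ ν d g) →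
      (∀ d, ∑ g, ν d g = 1) → ∃ b, recoveryProb (7 / 2 * ε) β ν b < 1 - δ) (hδ : δ < 1)
    [IsProbabilityMeasure ((sampleLaw (7 / 2 * ε)).map (extendMeasurement E₀ E))]
    (A : Learner n m Bool) :
    ¬ LearnsFromOutcomes ((sampleLaw (7 / 2 * ε)).map (extendMeasurement E₀ E)) ε δ γ A := by
  intro hA
  let A' : (Fin m → Option ι) → (Fin m → Bool) → ProbabilityMeasure (QState n) :=
    fun j x => A (fun l => extendMeasurement E₀ E (j l)) x
  have hτ : 0 ≤ 7 / 2 * ε := by positivity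
  have hτ1 : 7 / 2 * ε ≤ 1 := by linarith
  have : IsProbabilityMeasure (sampleLaw (7 / 2 * ε) : Measure (Option ι)) :=
    isProbabilityMeasure_sampleLaw hτ hτ1
  obtain ⟨b, hb⟩ := hrec (guessLaw E A') (fun d g => measureReal_nonneg) (sum_guessLaw E A')
  refine absurd (((hA (ρ b)).trans (lintegral_pi_map_le _ _ _)).trans (le_trans (le_of_eq ?_)
    (sum_le_ofReal_recoveryProb hτ hτ1 hβ0 hβ1 E
      (fun σ hσ => hammingDist_guess_le hε hγβ E₀ E (hρ b) hσ) A'))) ?_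
  · refine Finset.sum_congr rfl fun j _ => ?_
    rw [Finset.mul_sum]
    refine Finset.sum_congr rfl fun x _ => ?_
    rw [← mul_assoc]
    congr 1
    simp only [sampleLaw_singleton]
    rw [← ENNReal.ofReal_prod_of_nonneg fun l _ => sampleWeight_nonneg hτ hτ1 _,
      ← ENNReal.ofReal_mul (Finset.prod_nonneg fun l _ => sampleWeight_nonneg hτ hτ1 _),
      outcomeProb, ← Finset.prod_mul_distrib]
    congr 1
    refine Finset.prod_congr rfl fun l _ => ?_
    rw [obsProb_eq_mul]
    congr 1
    cases j l with
    | none => simp [extendMeasurement, hρ₀]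
    | some i =>
      simp only [extendMeasurement, hρ]
      cases x l <;> cases b i <;> simp <;> ring
  · rw [not_le]
    exact (ENNReal.ofReal_lt_ofReal_iff (by linarith)).mpr hb

/-- The exact acceptance probabilities are valid estimates for every `η ≥ 0`, and they reveal
exactly the sampled bits. This is the recovery problem with channel bias `1`, whatever `β` is. -/
theorem not_learnsFromEstimates [Nonempty ι] [MeasurableSpace (Option ι)]
    [DiscreteMeasurableSpace (Option ι)] {m : ℕ} {ε δ γ η β : ℝ} (hε : 0 < ε) (hε1 : ε < 1 / 4)
    (hη : 0 ≤ η) (hγβ : 2 * γ < β) {E₀ : Measurement n} {E : ι → Measurement n}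
    {ρ : (ι → Bool) → QState n} (hρ₀ : ∀ b, acceptProb E₀ (ρ b) = 0)
    (hρ : ∀ b i, acceptProb (E i) (ρ b) = (1 + β * (if b i then 1 else -1)) / 2)
    (hrec : ∀ ν : (Fin m → Option ι × Bool) → (ι → Bool) → ℝ, (∀ d g, 0 ≤ ν d g) →
      (∀ d, ∑ g, ν d g = 1) → ∃ b, recoveryProb (7 / 2 * ε) 1 ν b < 1 - δ) (hδ : δ < 1)
    [IsProbabilityMeasure ((sampleLaw (7 / 2 * ε)).map (extendMeasurement E₀ E))]
    (A : Learner n m ℝ) :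
    ¬ LearnsFromEstimates ((sampleLaw (7 / 2 * ε)).map (extendMeasurement E₀ E)) ε δ γ η A := by
  intro hA
  let value : Option ι → Bool → ℝ := fun o x =>
    o.elim 0 fun _ => (1 + β * (if x then 1 else -1)) / 2
  let A' : (Fin m → Option ι) → (Fin m → Bool) → ProbabilityMeasure (QState n) :=
    fun j x => A (fun l => extendMeasurement E₀ E (j l)) fun l => value (j l) (x l)
  have hτ : 0 ≤ 7 / 2 * ε := by positivity
  have hτ1 : 7 / 2 * ε ≤ 1 := by linarith
  have : IsProbabilityMeasure (sampleLaw (7 / 2 * ε) : Measure (Option ι)) :=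
    isProbabilityMeasure_sampleLaw hτ hτ1
  obtain ⟨b, hb⟩ := hrec (guessLaw E A') (fun d g => measureReal_nonneg) (sum_guessLaw E A')
  have hp := hA (ρ b) (fun F l => acceptProb (F l) (ρ b))
    (measurable_pi_lambda _ fun l =>
      (continuous_acceptProb_left (ρ b)).measurable.comp (measurable_pi_apply l))
    (fun F l => by simpa using hη)
  refine absurd ((hp.trans (lintegral_pi_map_le _ _ _)).trans (le_trans ?_
    (sum_le_ofReal_recoveryProb hτ hτ1 zero_le_one le_rfl E
      (fun σ hσ => hammingDist_guess_le hε hγβ E₀ E (hρ b) hσ) A'))) ?_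
  · refine Finset.sum_le_sum fun j _ => ?_
    -- The true bits, with `false` for the zero measurement; at bias `1` they carry the full
    -- sampling weight of `j`, so this one term of the sum suffices.
    let x : Fin m → Bool := fun l => (j l).elim false b
    refine le_trans (le_of_eq ?_) (Finset.single_le_sum
      (f := fun x : Fin m → Bool => ENNReal.ofReal (∏ l, obsProb (7 / 2 * ε) 1 b (j l, x l)) *
        (A' j x : Measure (QState n)) _) (fun _ _ => zero_le) (Finset.mem_univ x))
    have h1 : (fun l => acceptProb (extendMeasurement E₀ E (j l)) (ρ b))
        = fun l => value (j l) (x l) := by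
      funext l
      simp only [x, value]
      cases j l with
      | none => simp [extendMeasurement, hρ₀]
      | some i => exact hρ b i
    have h2 : ∀ l, obsProb (7 / 2 * ε) 1 b (j l, x l) = sampleWeight (7 / 2 * ε) (j l) := fun l => by
      simp only [x]
      cases j l <;> simp [obsProb, sampleWeight]
    simp only [h1, h2, A', sampleLaw_singleton]
    rw [ENNReal.ofReal_prod_of_nonneg fun l _ => sampleWeight_nonneg hτ hτ1 _]
  · rw [not_le]
    exact (ENNReal.ofReal_lt_ofReal_iff (by linarith)).mpr hb

end Learning

/-! ### Sample sizes -/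

lemma one_add_pow_le {x : ℝ} {m : ℕ} (hx : 0 ≤ x) (h : x * m ≤ 4 / 10000) :
    (1 + x) ^ m ≤ 1 + 9 / 10000 := by
  have h1 : (1 + x) ^ m ≤ Real.exp (x * m) := by
    rw [mul_comm, Real.exp_nat_mul]
    exact pow_le_pow_left₀ (by linarith) (by linarith [Real.add_one_le_exp x]) m
  have h2 := Real.add_one_le_exp (-(x * m))
  rw [Real.exp_neg] at h2
  have h3 := Real.exp_pos (x * m)
  have h4 : (-(x * m) + 1) * Real.exp (x * m) ≤ 1 := by
    calc _ ≤ (Real.exp (x * m))⁻¹ * Real.exp (x * m) := by gcongr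
      _ = 1 := inv_mul_cancel₀ h3.ne'
  nlinarith

lemma two_mul_lt_pow {ε δ : ℝ} {m : ℕ} (hε : 0 < ε) (hε1 : ε < 1 / 4) (hδ : 0 < δ) (hδ1 : δ < 1 / 4)
    (hm : 56 * (ε * m) ≤ Real.log (1 / δ)) : 2 * δ < (1 - 7 / 2 * ε) ^ m := by
  -- The rate `28` is what `ε < 1 / 4` allows: `(1 - 7 / 2 * ε) * (1 + 28 * ε) - 1 = 98 * ε * (1 / 4
  -- - ε)`. The power is then at least `√δ`, which exceeds `2 * δ` because `δ < 1 / 4`.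
  have h1 : Real.exp (-(28 * ε)) ≤ 1 - 7 / 2 * ε := by
    have h2 := Real.add_one_le_exp (28 * ε)
    rw [Real.exp_neg, inv_le_iff_one_le_mul₀ (Real.exp_pos _)]
    have h3 : (1 - 7 / 2 * ε) * (28 * ε + 1) ≤ (1 - 7 / 2 * ε) * Real.exp (28 * ε) :=
      mul_le_mul_of_nonneg_left h2 (by linarith)
    nlinarith
  have h4 : Real.exp (-(Real.log (1 / δ) / 2)) ≤ (1 - 7 / 2 * ε) ^ m := by
    calc _ ≤ Real.exp (m * -(28 * ε)) := Real.exp_le_exp.mpr (by linarith)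
      _ = Real.exp (-(28 * ε)) ^ m := Real.exp_nat_mul _ _
      _ ≤ _ := pow_le_pow_left₀ (Real.exp_pos _).le h1 m
  refine lt_of_lt_of_le ?_ h4
  have h5 : Real.exp (-(Real.log (1 / δ) / 2)) ^ 2 = δ := by
    rw [← Real.exp_nat_mul]
    have : ((2 : ℕ) : ℝ) * -(Real.log (1 / δ) / 2) = Real.log δ := by
      rw [one_div, Real.log_inv]; push_cast; ring
    rw [this, Real.exp_log hδ]
  have h6 := Real.exp_pos (-(Real.log (1 / δ) / 2))
  generalize Real.exp (-(Real.log (1 / δ) / 2)) = s at *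
  nlinarith

lemma exists_recoveryProb_lt {ι : Type*} [Fintype ι] [DecidableEq ι] [Nonempty ι] {m : ℕ}
    {ε δ β c Q : ℝ} (hε : 0 < ε) (hε1 : ε < 1 / 4) (hδ : 0 < δ) (hδ1 : δ < 1 / 4) (hβ : 0 ≤ β)
    (hβ1 : β ≤ 1) (hc : 0 ≤ c) (hc1 : c ≤ 1 / 112) (hm : (m : ℝ) ≤ c * (1 / ε * (Q + Real.log (1 / δ))))
    (hQ : 7 * c * β ^ 2 * Q ≤ 4 / 10000 * Fintype.card ι)
    {ν : (Fin m → Option ι × Bool) → (ι → Bool) → ℝ} (hν0 : ∀ d g, 0 ≤ ν d g)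
    (hν1 : ∀ d, ∑ g, ν d g = 1) : ∃ b, recoveryProb (7 / 2 * ε) β ν b < 1 - δ := by
  have hk : (0 : ℝ) < Fintype.card ι := by exact_mod_cast Fintype.card_pos
  have hL : 0 ≤ Real.log (1 / δ) := Real.log_nonneg (by rw [le_div_iff₀ hδ]; linarith)
  have hm' : ε * m ≤ c * (Q + Real.log (1 / δ)) := by
    calc ε * m ≤ ε * (c * (1 / ε * (Q + Real.log (1 / δ)))) := by gcongr
      _ = _ := by field_simp
  -- The larger of the two terms bounds the sum up to a factor `2`, and decides which obstruction
  -- applies.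
  rcases le_total Q (Real.log (1 / δ)) with h | h
  · refine exists_recoveryProb_lt_of_unobserved (by positivity) (by linarith) hβ hβ1
      (two_mul_lt_pow hε hε1 hδ hδ1 ?_) hν0 hν1
    have h1 : c * (Q + Real.log (1 / δ)) ≤ c * (2 * Real.log (1 / δ)) := by gcongr; linarith
    nlinarith
  · have hx : β ^ 2 * (7 / 2 * ε) / Fintype.card ι * m ≤ 4 / 10000 := by
      rw [div_mul_eq_mul_div, div_le_iff₀ hk]
      have h1 : c * (Q + Real.log (1 / δ)) ≤ c * (2 * Q) := by gcongr; linarith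
      calc β ^ 2 * (7 / 2 * ε) * m = β ^ 2 * (7 / 2) * (ε * m) := by ring
        _ ≤ β ^ 2 * (7 / 2) * (c * (2 * Q)) :=
            mul_le_mul_of_nonneg_left (hm'.trans h1) (by positivity)
        _ ≤ _ := by linarith
    obtain ⟨b, hb⟩ := exists_recoveryProb_lt_of_chiSq (by positivity) (by linarith) hβ hβ1
      (one_add_pow_le (by positivity) hx) hν0 hν1
    exact ⟨b, by linarith⟩

/-- One law serves both models. In the constant, one factor `K ^ 2` pays for the number of hidden
bits; the other pays for `β ^ 2 ≤ 32 * γ ^ 2 / K ^ 2`, needed only for outcomes. -/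
lemma exists_unlearnable_law {K γ ε δ : ℝ} {n : ℕ} (hK : 0 < K) (hK1 : K ≤ 1) (hn : 0 < n)
    (hγ : K * √(n : ℝ) * (2 : ℝ) ^ (-(n : ℝ) / 70) ≤ γ) (hγ2 : γ < 1 / 2) (hε : 0 < ε)
    (hε1 : ε < 1 / 4) (hδ : 0 < δ) (hδ1 : δ < 1 / 4) :
    ∃ (D : Measure (Measurement n)) (_ : IsProbabilityMeasure D),
      (∀ m : ℕ, (m : ℝ) ≤ K ^ 4 / 10 ^ 8 * (1 / ε * (n / γ ^ 2 + Real.log (1 / δ))) →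
        ¬ ∃ A : Learner n m ℝ, LearnsFromEstimates D ε δ γ (γ ^ 2 / n) A) ∧
      (∀ m : ℕ, (m : ℝ) ≤ K ^ 4 / 10 ^ 8 * (1 / ε * (n / γ ^ 4 + Real.log (1 / δ))) →
        ¬ ∃ A : Learner n m Bool, LearnsFromOutcomes D ε δ γ A) := by
  obtain ⟨s, M, β, F, hs, hM, hγβ, hβ1, hβγ, hsM, hF, hdesign⟩ := exists_design hK hK1 hn hγ hγ2
  have hn0 : (0 : ℝ) < n := by exact_mod_cast hn
  have hγ0 : 0 < γ := lt_of_lt_of_le (by positivity) hγ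
  have hβ0 : 0 ≤ β := by linarith
  have : Nonempty (Fin s × Fin M) := ⟨(⟨0, hs⟩, ⟨0, hM⟩)⟩
  let sgn : Bool → ℝ := fun x => if x then 1 else -1
  choose p hp hpF using fun b : Fin s × Fin M → Bool =>
    hdesign (fun i => sgn (b i)) fun i => by cases h : b i <;> simp [sgn]
  obtain ⟨toE, toS, hacc⟩ := exists_measurement_state (n := n)
  let E₀ : Measurement n := toE ⟨fun _ => 0, fun _ => by simp⟩
  let E : Fin s × Fin M → Measurement n := fun i => toE ⟨fun x => (1 + F x i) / 2, fun x => by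
    have := abs_le.mp (hF x i)
    constructor <;> linarith⟩
  let ρ : (Fin s × Fin M → Bool) → QState n := fun b => toS ⟨p b, hp b⟩
  have hρ₀ : ∀ b, acceptProb E₀ (ρ b) = 0 := fun b => by simp [E₀, ρ, hacc]
  have hρ : ∀ b i, acceptProb (E i) (ρ b) = (1 + β * (if b i then 1 else -1)) / 2 := fun b i => by
    have h1 : ∑ x, (1 + F x i) / 2 * p b x = (∑ x, p b x + ∑ x, p b x * F x i) / 2 := by
      rw [← Finset.sum_add_distrib, Finset.sum_div]
      exact Finset.sum_congr rfl fun x _ => by ring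
    simp only [E, ρ, hacc, h1, (hp b).2, hpF, sgn]
  let _ : MeasurableSpace (Option (Fin s × Fin M)) := ⊤
  have hprob : IsProbabilityMeasure (sampleLaw (7 / 2 * ε) : Measure (Option (Fin s × Fin M))) :=
    isProbabilityMeasure_sampleLaw (by positivity) (by linarith)
  have hD : IsProbabilityMeasure ((sampleLaw (7 / 2 * ε)).map (extendMeasurement E₀ E)) :=
    Measure.isProbabilityMeasure_map Measurable.of_discrete.aemeasurable
  have hcard : (Fintype.card (Fin s × Fin M) : ℝ) = s * M := by simp
  have hc0 : 0 ≤ K ^ 4 / 10 ^ 8 := by positivity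
  have hc1 : K ^ 4 / 10 ^ 8 ≤ 1 / 112 := by
    have := pow_le_one₀ (n := 4) hK.le hK1
    linarith
  have hK2 : K ^ 2 ≤ 1 := pow_le_one₀ hK.le hK1
  refine ⟨_, hD, fun m hm => ?_, fun m hm => ?_⟩
  · rintro ⟨A, hA⟩
    refine not_learnsFromEstimates hε hε1 (by positivity) hγβ hρ₀ hρ (fun ν hν0 hν1 =>
      exists_recoveryProb_lt hε hε1 hδ hδ1 zero_le_one le_rfl hc0 hc1 hm ?_ hν0 hν1)
      (by linarith) A hA
    rw [hcard]
    refine le_trans ?_ (mul_le_mul_of_nonneg_left hsM (by norm_num))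
    calc 7 * (K ^ 4 / 10 ^ 8) * 1 ^ 2 * (n / γ ^ 2)
        = 7 * 64 / 10 ^ 8 * K ^ 2 * (n * K ^ 2 / (64 * γ ^ 2)) := by field_simp
      _ ≤ 4 / 10000 * (n * K ^ 2 / (64 * γ ^ 2)) := by gcongr; linarith
  · rintro ⟨A, hA⟩
    refine not_learnsFromOutcomes hε hε1 hβ0 hβ1 hγβ hρ₀ hρ (fun ν hν0 hν1 =>
      exists_recoveryProb_lt hε hε1 hδ hδ1 hβ0 hβ1 hc0 hc1 hm ?_ hν0 hν1)
      (by linarith) A hA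
    rw [hcard]
    refine le_trans ?_ (mul_le_mul_of_nonneg_left hsM (by norm_num))
    calc 7 * (K ^ 4 / 10 ^ 8) * β ^ 2 * (n / γ ^ 4)
        ≤ 7 * (K ^ 4 / 10 ^ 8) * (32 * γ ^ 2 / K ^ 2) * (n / γ ^ 4) := by gcongr
      _ = 7 * 64 * 32 / 10 ^ 8 * (n * K ^ 2 / (64 * γ ^ 2)) := by field_simp
      _ ≤ 4 / 10000 * (n * K ^ 2 / (64 * γ ^ 2)) :=
          mul_le_mul_of_nonneg_right (by norm_num) (by positivity)

end QuantumLearning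

theorem mainTheorem7 :
    ∀ K : ℝ, 0 < K → ∃ c : ℝ, 0 < c ∧
      ∀ (n : ℕ) (ε δ γ : ℝ), 0 < n → 0 < ε → ε < 1 / 4 → 0 < δ → δ < 1 / 4 →
        K * √(n : ℝ) * (2 : ℝ) ^ (-(n : ℝ) / 70) ≤ γ → γ < 1 / 2 →
        ∃ (D : MeasureTheory.Measure (QuantumLearning.Measurement n))
          (_ : MeasureTheory.IsProbabilityMeasure D),
          (∀ m : ℕ, (m : ℝ) ≤ c * (1 / ε * (n / γ ^ 2 + Real.log (1 / δ))) →
            ¬ ∃ A : QuantumLearning.Learner n m ℝ,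
              QuantumLearning.LearnsFromEstimates D ε δ γ (γ ^ 2 / n) A) ∧
          (∀ m : ℕ, (m : ℝ) ≤ c * (1 / ε * (n / γ ^ 4 + Real.log (1 / δ))) →
            ¬ ∃ A : QuantumLearning.Learner n m Bool,
              QuantumLearning.LearnsFromOutcomes D ε δ γ A) := by
  intro K hK
  -- The design needs `K ≤ 1`; lowering `K` only weakens the condition on `γ`.
  have hK' : 0 < min K 1 := lt_min hK one_pos
  refine ⟨min K 1 ^ 4 / 10 ^ 8, by positivity, fun n ε δ γ hn hε hε1 hδ hδ1 hγ hγ2 =>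
    QuantumLearning.exists_unlearnable_law hK' (min_le_right _ _) hn (le_trans ?_ hγ) hγ2 hε hε1
      hδ hδ1⟩
  gcongr
  exact min_le_left _ _
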